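/- Theorem 1. Consider the W-streaming model: the edges of an undirected loopless multigraph on the vertex set $\{0,\dots,n-1\}$, $n\ge 1$, arrive one at a time, in an arbitrary (adversarial) order fixed before the algorithm starts. At each arrival, and once more at the end of the stream, a randomized algorithm that knows $n$ but not the maximum degree tosses fresh fair coins, computes from its memory, the arriving token and these coins the new content of its memory (a bit string), and appends pairs (edge, color) to a write-only output; earlier tokens, coins and outputs remain available to it only as far as they are stored in its memory. Its space is the largest number of bits held in memory between arrivals, or of coins tossed at one arrival, whichever is larger. For every constant $K\in\mathbb N$ there are a one-pass W-streaming algorithm of this kind (a single one for all $n$, all of whose operations are computable) and constants $C, c$ such that for every $n\ge 1$ and every such stream, with $\Delta$ the maximum degree of the multigraph (parallel edges counted with multiplicity): 1. for every outcome of the coins, the space is at most $C\,n\,\log^{c}(n+2)\cdot\log(n+\Delta+2)$ bits, that is, $\tilde O(n)$ words of $O(\log (n+\Delta+2))$ bits each; 2. for every outcome of the coins, the output is a proper edge coloring: each edge (each parallel copy separately) is output with exactly one color, and any two different edges with a common endpoint have different colors; 3. with probability at least $1-n^{-K}$, the number of different colors used is at most $C\,\Delta^{1.5}\log^{c}(\Delta+2)$,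 that is, $\tilde O(\Delta^{1.5})$. -/

import Mathlib

namespace WStreaming

/-- An edge token `(u, v)`: the undirected edge `{u, v}`, its endpoints given in either order.
Vertices of an `n`-vertex graph are `0, …, n - 1`. -/
abbrev Edge := ℕ × ℕ

/-- What the algorithm reads at one time: an edge, or `none`, the end of the stream. -/
abbrev Token := Option Edge

/-- The content of the working memory, a string of bits. -/
abbrev Mem := List Bool

/-- A record of the write-only output stream: an edge together with its color. -/
abbrev Out := Edge × ℕ

/-- The stream of a loopless multigraph on the vertices `0, …, n - 1`: its edges, listed in an
arbitrary order, parallel edges as often as they occur. -/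
def IsEdgeStream (n : ℕ) (s : List Edge) : Prop :=
  ∀ e ∈ s, e.1 < n ∧ e.2 < n ∧ e.1 ≠ e.2

/-- The degree of `v` in the multigraph with edge list `s`. -/
def degree (s : List Edge) (v : ℕ) : ℕ :=
  s.countP (fun e => decide (e.1 = v ∨ e.2 = v))

/-- The maximum degree of the multigraph on `0, …, n - 1` with edge list `s`. -/
def maxDegree (n : ℕ) (s : List Edge) : ℕ :=
  (Finset.range n).sup (degree s)

/-- The undirected edge of a token. -/
def Edge.undirected (e : Edge) : Sym2 ℕ := s(e.1, e.2)

/-- The output `o` is a proper edge coloring of the multigraph with edge list `s`: every edge is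
output with exactly one color (parallel edges separately), and any two output edges that share an
endpoint (in particular two parallel ones) carry different colors. -/
def IsProperEdgeColoring (s : List Edge) (o : List Out) : Prop :=
  (o.map fun p => p.1.undirected).Perm (s.map Edge.undirected) ∧
  o.Pairwise fun p q =>
    (∃ v, v ∈ p.1.undirected ∧ v ∈ q.1.undirected) → p.2 ≠ q.2

/-- The number of different colors in an output. -/
def numColors (o : List Out) : ℕ := (o.map Prod.snd).toFinset.card

/-- A one-pass randomized W-streaming algorithm. It knows the number `n` of vertices. When a
token arrives, it tosses `coins` fresh fair coins, and from its memory, the token and the coins it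
computes its new memory and a list of records that it appends to its output. It keeps nothing
else: earlier tokens, coins and outputs are available to it only as far as its memory holds them.
One and the same algorithm serves all `n`, and all its operations are computable. -/
structure Algorithm where
  init : ℕ → Mem
  coins : ℕ → Mem → Token → ℕ
  step : ℕ → Mem → Token → List Bool → Mem × List Out
  computable_init : Computable init
  computable_coins : Computable fun x : ℕ × Mem × Token => coins x.1 x.2.1 x.2.2
  computable_step : Computable fun x : ℕ × Mem × Token × List Bool =>
    step x.1 x.2.1 x.2.2.1 x.2.2.2

/-- The outcome of `k` independent fair coins. -/
noncomputable def coinTosses (k : ℕ) : PMF (List Bool) :=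
  (PMF.uniformOfFintype (Fin k → Bool)).map List.ofFn

/-- The tokens that are read on the stream `s`: its edges, then the end of the stream. -/
def tokens (s : List Edge) : List Token := s.map some ++ [none]

namespace Algorithm

/-- One step on token `t`, from memory `c.1` with `c.2` already output. -/
noncomputable def execStep (A : Algorithm) (n : ℕ) (c : Mem × List Out) (t : Token) :
    PMF (Mem × List Out) :=
  (coinTosses (A.coins n c.1 t)).map fun r =>
    ((A.step n c.1 t r).1, c.2 ++ (A.step n c.1 t r).2)

/-- The distribution of the memory and the output so far, after the tokens `ts` were read. -/
noncomputable def run (A : Algorithm) (n : ℕ) (ts : List Token) : PMF (Mem × List Out) :=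
  ts.foldl (fun p t => p.bind fun c => A.execStep n c t) (PMF.pure (A.init n, []))

/-- The distribution of the complete output on the stream `s`. -/
noncomputable def output (A : Algorithm) (n : ℕ) (s : List Edge) : PMF (List Out) :=
  (A.run n (tokens s)).map Prod.snd

/-- On the stream `s`, whatever the coins show, the memory never holds more than `S` bits, and no
step tosses more than `S` coins. -/
def SpaceAtMost (A : Algorithm) (n : ℕ) (s : List Edge) (S : ℝ) : Prop :=
  (∀ ts, ts <+: tokens s → ∀ c ∈ (A.run n ts).support, (c.1.length : ℝ) ≤ S) ∧
  (∀ ts t, ts ++ [t] <+: tokens s → ∀ c ∈ (A.run n ts).support, (A.coins n c.1 t : ℝ) ≤ S)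

end Algorithm

end WStreaming

namespace WStreaming

open Encodable

/-! ### The algorithm -/

/-! Write L = `n.size`. Edges are collected in batches of nL² and a full batch is colored at once,
so the memory holds only one batch, the n degree counters and n masks. Let p be the bit length of
the largest degree so far (the phase) and τ = 2^⌈p/2⌉ L². A color is a list `g :: κ` with a key κ
and a greedy index g that separates adjacent edges of one batch. The keys must do two things: differ
on adjacent edges of different batches, and make g small.

If both endpoints of an edge have degree at most τ in the batch, the key is the sum of all degrees,
which identifies the batch. Here g ≤ 2τ, and there are at most Δ/(2L²) full batches, which gives
O(Δ^1.5) colors (`card_lowColors_le`).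

Every other edge is directed from a center of batch degree above τ to a leaf. Its key consists of
the phase, a label `side`, the quotient deg(center)/τ, and the rank of the edge at its leaf, XORed
with a random p-bit mask of that leaf. Consecutive directed edges have different labels, so two
adjacent edges with the same label share their center or their leaf. In different batches of one
phase, a common center forces different quotients, because its degree grew by more than τ. A common
leaf forces different ranks, and XOR with a fixed mask keeps them different. Hence the coloring is
always proper (`RecordInv.color_ne`).

The same argument inside a batch shows that g counts at most the edges at one center whose masked
ranks agree (`batchColor_le_card`). A center has at most 2^p edges and the masks of distinct leaves
are independent, so for a fixed pattern the exponential moment E[2^count] is at most e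
(`sum_two_pow_maskBits_le`). Markov's inequality and a union bound over tokens, centers and patterns
give g = O(K log n + log Δ) with probability 1 - n^(-K). The stream is oblivious and masks are
renewed only when the phase changes, so the mask in memory is uniform at each fixed time
(`map_fst_run`).

Phase p contributes about g · L · (2^p/τ) · 2^p colors of the second kind. The factor L² in τ
cancels the L of the labels and the log n in g, so the final bound has logarithms of Δ only
(`card_highColors_le`). -/

/-- The binary digit of `x` with weight `2 ^ i`. -/
def bitAt (x i : ℕ) : ℕ := x / 2 ^ i % 2

/-- The least position at which the binary expansions of `u` and `v` differ. -/
def splitLevel (u v : ℕ) : ℕ := (List.range (u + v)).findIdx fun i => bitAt u i ≠ bitAt v i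

/-- A label of the ordered pair `(u, v)` such that consecutive pairs have different labels. -/
def side (u v : ℕ) : ℕ := 2 * splitLevel u v + bitAt u (splitLevel u v)

/-- The `p` low bits of `c`, masked by the `v`-th block of `p` bits of `R`. -/
def maskBits (p : ℕ) (R : List ℕ) (v c : ℕ) : List ℕ :=
  (List.range p).map fun i => (bitAt c i + R.getD (v * p + i) 0) % 2

/-- The maximum of a list. -/
def listMax (l : List ℕ) : ℕ := l.foldr max 0

/-- The phase of a list of degrees: the binary length of the maximum degree. -/
def phase (deg : List ℕ) : ℕ := (listMax deg).size

/-- The batch degree above which a vertex is a center in phase `p`. -/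
def threshold (n p : ℕ) : ℕ := 2 ^ ((p + 1) / 2) * n.size ^ 2

/-- The number of edges in a full buffer. -/
def capacity (n : ℕ) : ℕ := n * n.size ^ 2

/-- An edge directed from its center to its leaf. -/
def direct (τ : ℕ) (buf : List Edge) (e : Edge) : Edge :=
  if τ < degree buf e.1 then e else e.swap

/-- The key of a directed edge whose center has high batch degree. -/
def highKey (n : ℕ) (deg R : List ℕ) (buf pre : List Edge) (o : Edge) : List ℕ :=
  [phase deg, side o.1 o.2, deg.getD o.1 0 / threshold n (phase deg),
    encode (maskBits (phase deg) R o.2 (deg.getD o.2 0 - degree buf o.2 + degree pre o.2))]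

/-- The key of the edge `e` of the batch `buf`, in which it is preceded by the edges `pre`. -/
def key (n : ℕ) (deg R : List ℕ) (buf pre : List Edge) (e : Edge) : List ℕ :=
  if degree buf e.1 ≤ threshold n (phase deg) ∧ degree buf e.2 ≤ threshold n (phase deg) then
    [deg.sum]
  else highKey n deg R buf pre (direct (threshold n (phase deg)) buf e)

/-- The two edges have a common endpoint. -/
def Adj (e f : Edge) : Prop := e.1 = f.1 ∨ e.1 = f.2 ∨ e.2 = f.1 ∨ e.2 = f.2

instance : DecidableRel Adj := fun _ _ => inferInstanceAs (Decidable (_ ∨ _))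

/-- The colors of the edges in `acc` that are adjacent to `e`. -/
def usedColors (acc : List Out) (e : Edge) : List ℕ :=
  (acc.filter fun o => Adj o.1 e).map Prod.snd

/-- The least index `g` for which the color `g :: κ` is not in `used`. -/
def freshIndex (used κ : List ℕ) : ℕ :=
  (List.range (used.length + 1)).findIdx fun g => encode (g :: κ) ∉ used

/-- Color one more edge of the batch `buf`. -/
def colorStep (n : ℕ) (deg R : List ℕ) (buf : List Edge) (acc : List Out) (e : Edge) : List Out :=
  acc ++ [(e, encode (freshIndex (usedColors acc e) (key n deg R buf (acc.map Prod.fst) e) ::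
    key n deg R buf (acc.map Prod.fst) e))]

/-- Color the batch `buf`. -/
def colorBatch (n : ℕ) (deg R : List ℕ) (buf : List Edge) : List Out :=
  buf.foldl (colorStep n deg R buf) []

/-! ### Binary code of the memory, and the step of the algorithm. -/

/-- The binary digits of a number, the most significant first. -/
def digitsMSB (x : ℕ) : List ℕ := (List.range x.size).reverse.map (bitAt x)

/-- A self-delimiting code of a number. -/
def encNum (x : ℕ) : List Bool :=
  (digitsMSB x).flatMap (fun b => [false, decide (b = 1)]) ++ [true, false]

/-- A self-delimiting code of a list of numbers. -/
def encList (l : List ℕ) : List Bool := l.flatMap encNum ++ [true, true]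

/-- The memory content that represents a list of lists of numbers. -/
def encState (L : List (List ℕ)) : Mem := L.flatMap encList

/-- The state of the decoder: what kind of bit it expects, the current number, the current list and
the lists that are complete. -/
abbrev DecState := ℕ × ℕ × List ℕ × List (List ℕ)

/-- One step of the decoder. -/
def decStep (s : DecState) (b : Bool) : DecState :=
  if s.1 = 0 then (if b = true then 2 else 1, s.2)
  else if s.1 = 1 then (0, 2 * s.2.1 + (if b = true then 1 else 0), s.2.2)
  else if b = true then (0, 0, [], s.2.2.2 ++ [s.2.2.1])
  else (0, 0, s.2.2.1 ++ [s.2.1], s.2.2.2)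

/-- The lists represented by a memory content. -/
def decState (m : Mem) : List (List ℕ) := (m.foldl decStep (0, 0, [], [])).2.2.2

/-- The degrees after the token `t`. -/
def nextDeg (n : ℕ) (deg : List ℕ) (t : Token) : List ℕ :=
  (List.range n).map fun v => deg.getD v 0 + degree t.toList v

/-- The random bits used after a phase change or not. -/
def nextMask (deg deg' R : List ℕ) (r : List Bool) : List ℕ :=
  if phase deg = phase deg' then R else r.map fun b => if b = true then 1 else 0

/-- The step of the algorithm on decoded memory. -/
def coreStep (n : ℕ) (deg R : List ℕ) (buf : List Edge) (t : Token) (r : List Bool) :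
    Mem × List Out :=
  if t.toList = [] ∨ capacity n ≤ (buf ++ t.toList).length then
    (encState [nextDeg n deg t, nextMask deg (nextDeg n deg t) R r, []],
      colorBatch n (nextDeg n deg t) (nextMask deg (nextDeg n deg t) R r) (buf ++ t.toList))
  else
    (encState [nextDeg n deg t, nextMask deg (nextDeg n deg t) R r,
      (buf ++ t.toList).map fun e => Nat.pair e.1 e.2], [])

/-! ### Computability -/

section Computability

variable {α : Type*} [Primcodable α]

theorem primrec_pow {f g : α → ℕ} (hf : Primrec f) (hg : Primrec g) :
    Primrec fun a => f a ^ g a :=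
  (Primrec₂.unpaired'.1 Nat.Primrec.pow).comp hf hg

/-- Bounded search makes the bit length primitive recursive. The factor 2 on the right replaces the
exponent k - 1, and the search bound x gives the value 0 at x = 0. -/
theorem size_eq_findGreatest (x : ℕ) : x.size = Nat.findGreatest (fun k => 2 ^ k ≤ 2 * x) x := by
  symm
  rw [Nat.findGreatest_eq_iff]
  refine ⟨Nat.size_le.2 Nat.lt_two_pow_self, fun h => ?_, fun k hk _ h => ?_⟩
  · have := Nat.lt_size.1 (Nat.sub_lt (Nat.pos_of_ne_zero h) one_pos)
    rw [← Nat.sub_add_cancel (Nat.one_le_iff_ne_zero.2 h), pow_succ]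
    omega
  · have h1 := Nat.lt_size_self x
    have h2 : 2 ^ (x.size + 1) ≤ 2 ^ k := Nat.pow_le_pow_right two_pos hk
    rw [pow_succ] at h2
    omega

theorem primrec_size {f : α → ℕ} (hf : Primrec f) : Primrec fun a => (f a).size := by
  refine (Primrec.nat_findGreatest (p := fun a k => 2 ^ k ≤ 2 * f a) hf ?_).of_eq
    fun a => (size_eq_findGreatest _).symm
  exact Primrec.nat_le.comp (primrec_pow (Primrec.const 2) Primrec.snd)
    (Primrec.nat_mul.comp (Primrec.const 2) (hf.comp Primrec.fst))

theorem primrec_bitAt {f g : α → ℕ} (hf : Primrec f) (hg : Primrec g) :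
    Primrec fun a => bitAt (f a) (g a) :=
  Primrec.nat_mod.comp (Primrec.nat_div.comp hf (primrec_pow (Primrec.const 2) hg))
    (Primrec.const 2)

theorem primrec_splitLevel {f g : α → ℕ} (hf : Primrec f) (hg : Primrec g) :
    Primrec fun a => splitLevel (f a) (g a) := by
  refine Primrec.list_findIdx (Primrec.list_range.comp (Primrec.nat_add.comp hf hg)) ?_
  have h : PrimrecPred fun x : α × ℕ => bitAt (f x.1) x.2 ≠ bitAt (g x.1) x.2 :=
    (Primrec.eq.comp (primrec_bitAt (hf.comp Primrec.fst) Primrec.snd)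
      (primrec_bitAt (hg.comp Primrec.fst) Primrec.snd)).not
  exact primrecPred_iff_primrec_decide.1 h

theorem primrec_side {f g : α → ℕ} (hf : Primrec f) (hg : Primrec g) :
    Primrec fun a => side (f a) (g a) :=
  Primrec.nat_add.comp (Primrec.nat_mul.comp (Primrec.const 2) (primrec_splitLevel hf hg))
    (primrec_bitAt hf (primrec_splitLevel hf hg))

theorem primrec_getD {β : Type*} [Primcodable β] {l : α → List β} {i : α → ℕ} (d : β)
    (hl : Primrec l) (hi : Primrec i) : Primrec fun a => (l a).getD (i a) d :=
  (Primrec.list_getD d).comp hl hi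

theorem primrec_maskBits {p v c : α → ℕ} {R : α → List ℕ} (hp : Primrec p) (hR : Primrec R)
    (hv : Primrec v) (hc : Primrec c) : Primrec fun a => maskBits (p a) (R a) (v a) (c a) := by
  refine Primrec.list_map (Primrec.list_range.comp hp) ?_
  refine Primrec.nat_mod.comp (Primrec.nat_add.comp (primrec_bitAt (hc.comp Primrec.fst)
    Primrec.snd) ?_) (Primrec.const 2)
  exact primrec_getD 0 (hR.comp Primrec.fst) (Primrec.nat_add.comp
    (Primrec.nat_mul.comp (hv.comp Primrec.fst) (hp.comp Primrec.fst)) Primrec.snd)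

theorem primrec_phase {l : α → List ℕ} (hl : Primrec l) : Primrec fun a => phase (l a) :=
  primrec_size (Primrec.list_foldr hl (Primrec.const 0)
    (Primrec.nat_max.comp (Primrec.fst.comp Primrec.snd) (Primrec.snd.comp Primrec.snd)).to₂)

theorem primrec_threshold {n p : α → ℕ} (hn : Primrec n) (hp : Primrec p) :
    Primrec fun a => threshold (n a) (p a) :=
  Primrec.nat_mul.comp (primrec_pow (Primrec.const 2) (Primrec.nat_div.comp
    (Primrec.succ.comp hp) (Primrec.const 2))) (primrec_pow (primrec_size hn) (Primrec.const 2))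

theorem primrec_degree {s : α → List Edge} {v : α → ℕ} (hs : Primrec s) (hv : Primrec v) :
    Primrec fun a => degree (s a) (v a) := by
  have h : PrimrecRel fun (e : Edge) (v : ℕ) => e.1 = v ∨ e.2 = v :=
    PrimrecPred.or (Primrec.eq.comp (Primrec.fst.comp Primrec.fst) Primrec.snd)
      (Primrec.eq.comp (Primrec.snd.comp Primrec.fst) Primrec.snd)
  exact (Primrec.list_length.comp ((PrimrecRel.listFilter h).comp hs hv)).of_eq fun a => by
    rw [degree, List.countP_eq_length_filter]

theorem primrec_direct {τ : α → ℕ} {buf : α → List Edge} {e : α → Edge} (hτ : Primrec τ)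
    (hb : Primrec buf) (he : Primrec e) : Primrec fun a => direct (τ a) (buf a) (e a) :=
  Primrec.ite (Primrec.nat_lt.comp hτ (primrec_degree hb (Primrec.fst.comp he))) he
    (Primrec.pair (Primrec.snd.comp he) (Primrec.fst.comp he))

theorem primrec_sum {l : α → List ℕ} (hl : Primrec l) : Primrec fun a => (l a).sum :=
  Primrec.list_foldr hl (Primrec.const 0)
    (Primrec.nat_add.comp (Primrec.fst.comp Primrec.snd) (Primrec.snd.comp Primrec.snd)).to₂

theorem primrec_highKey {n : α → ℕ} {deg R : α → List ℕ} {buf pre : α → List Edge} {o : α → Edge}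
    (hn : Primrec n) (hd : Primrec deg) (hR : Primrec R) (hb : Primrec buf) (hp : Primrec pre)
    (ho : Primrec o) :
    Primrec fun a => highKey (n a) (deg a) (R a) (buf a) (pre a) (o a) := by
  have h1 := Primrec.fst.comp ho
  have h2 := Primrec.snd.comp ho
  have hph := primrec_phase hd
  refine Primrec.list_cons.comp hph (Primrec.list_cons.comp (primrec_side h1 h2)
    (Primrec.list_cons.comp (Primrec.nat_div.comp (primrec_getD 0 hd h1)
      (primrec_threshold hn hph)) (Primrec.list_cons.comp ?_ (Primrec.const []))))
  exact Primrec.encode.comp (primrec_maskBits hph hR h2 (Primrec.nat_add.comp (Primrec.nat_sub.comp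
    (primrec_getD 0 hd h2) (primrec_degree hb h2)) (primrec_degree hp h2)))

theorem primrec_key {n : α → ℕ} {deg R : α → List ℕ} {buf pre : α → List Edge} {e : α → Edge}
    (hn : Primrec n) (hd : Primrec deg) (hR : Primrec R) (hb : Primrec buf) (hp : Primrec pre)
    (he : Primrec e) : Primrec fun a => key (n a) (deg a) (R a) (buf a) (pre a) (e a) := by
  have ht := primrec_threshold hn (primrec_phase hd)
  refine Primrec.ite (PrimrecPred.and
    (Primrec.nat_le.comp (primrec_degree hb (Primrec.fst.comp he)) ht)
    (Primrec.nat_le.comp (primrec_degree hb (Primrec.snd.comp he)) ht))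
    (Primrec.list_cons.comp (primrec_sum hd) (Primrec.const [])) ?_
  exact primrec_highKey hn hd hR hb hp (primrec_direct ht hb he)

theorem primrec_usedColors {acc : α → List Out} {e : α → Edge} (ha : Primrec acc)
    (he : Primrec e) : Primrec fun a => usedColors (acc a) (e a) := by
  have h : PrimrecRel fun (o : Out) (e : Edge) => Adj o.1 e := by
    have a1 := Primrec.fst.comp (Primrec.fst.comp (Primrec.fst (α := Out) (β := Edge)))
    have a2 := Primrec.snd.comp (Primrec.fst.comp (Primrec.fst (α := Out) (β := Edge)))
    have b1 := Primrec.fst.comp (Primrec.snd (α := Out) (β := Edge))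
    have b2 := Primrec.snd.comp (Primrec.snd (α := Out) (β := Edge))
    exact (Primrec.eq.comp a1 b1).or ((Primrec.eq.comp a1 b2).or
      ((Primrec.eq.comp a2 b1).or (Primrec.eq.comp a2 b2)))
  exact Primrec.list_map ((PrimrecRel.listFilter h).comp ha he)
    (Primrec.snd.comp Primrec.snd)

theorem primrec_freshIndex {used κ : α → List ℕ} (hu : Primrec used) (hκ : Primrec κ) :
    Primrec fun a => freshIndex (used a) (κ a) := by
  refine Primrec.list_findIdx (Primrec.list_range.comp (Primrec.succ.comp
    (Primrec.list_length.comp hu))) ?_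
  have hmem : PrimrecRel fun (l : List ℕ) (b : ℕ) => b ∈ l :=
    (PrimrecRel.exists_mem_list (R := fun a b : ℕ => a = b) Primrec.eq).of_eq fun l b => by simp
  have h : PrimrecPred fun x : α × ℕ => encode (x.2 :: κ x.1) ∉ used x.1 :=
    PrimrecPred.not (hmem.comp (hu.comp Primrec.fst)
      (Primrec.encode.comp (Primrec.list_cons.comp Primrec.snd (hκ.comp Primrec.fst))))
  exact primrecPred_iff_primrec_decide.1 h

theorem primrec_colorBatch {n : α → ℕ} {deg R : α → List ℕ} {buf : α → List Edge}
    (hn : Primrec n) (hd : Primrec deg) (hR : Primrec R) (hb : Primrec buf) :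
    Primrec fun a => colorBatch (n a) (deg a) (R a) (buf a) := by
  refine Primrec.list_foldl (h := fun a x => colorStep (n a) (deg a) (R a) (buf a) x.1 x.2) hb
    (Primrec.const []) ?_
  have hacc : Primrec fun x : α × List Out × Edge => x.2.1 := Primrec.fst.comp Primrec.snd
  have he : Primrec fun x : α × List Out × Edge => x.2.2 := Primrec.snd.comp Primrec.snd
  have hpre : Primrec fun x : α × List Out × Edge => x.2.1.map Prod.fst :=
    Primrec.list_map hacc (Primrec.fst.comp Primrec.snd).to₂
  have hκ := primrec_key (hn.comp (Primrec.fst (β := List Out × Edge)))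
    (hd.comp Primrec.fst) (hR.comp Primrec.fst) (hb.comp Primrec.fst)
    hpre he
  exact Primrec.list_append.comp hacc (Primrec.list_cons.comp (Primrec.pair he
    (Primrec.encode.comp (Primrec.list_cons.comp
      (primrec_freshIndex (primrec_usedColors hacc he) hκ) hκ))) (Primrec.const []))

theorem primrec_encNum : Primrec encNum := by
  refine Primrec.list_append.comp (Primrec.list_flatMap (Primrec.list_map
    (Primrec.list_reverse.comp (Primrec.list_range.comp (primrec_size Primrec.id)))
    (primrec_bitAt Primrec.fst Primrec.snd)) ?_) (Primrec.const [true, false])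
  exact Primrec.list_cons.comp (Primrec.const false) (Primrec.list_cons.comp
    (primrecPred_iff_primrec_decide.1 (Primrec.eq.comp Primrec.snd (Primrec.const 1)))
    (Primrec.const []))

theorem primrec_encState : Primrec encState := by
  refine Primrec.list_flatMap Primrec.id (Primrec.list_append.comp
    (Primrec.list_flatMap Primrec.snd (primrec_encNum.comp Primrec.snd)) (Primrec.const _))

theorem primrec_decStep : Primrec₂ decStep := by
  have hs := Primrec.fst (α := DecState) (β := Bool)
  have hb : PrimrecPred fun x : DecState × Bool => x.2 = true :=
    Primrec.eq.comp Primrec.snd (Primrec.const true)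
  have h1 := Primrec.fst.comp hs
  have h2 := Primrec.snd.comp hs
  have h21 := Primrec.fst.comp h2
  have h22 := Primrec.snd.comp h2
  have h221 := Primrec.fst.comp h22
  have h222 := Primrec.snd.comp h22
  refine Primrec.ite (Primrec.eq.comp h1 (Primrec.const 0))
    (Primrec.pair (Primrec.ite hb (Primrec.const 2) (Primrec.const 1)) h2)
    (Primrec.ite (Primrec.eq.comp h1 (Primrec.const 1)) (Primrec.pair (Primrec.const 0)
      (Primrec.pair (Primrec.nat_add.comp (Primrec.nat_mul.comp (Primrec.const 2) h21)
        (Primrec.ite hb (Primrec.const 1) (Primrec.const 0))) h22)) (Primrec.ite hb ?_ ?_))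
  · exact Primrec.pair (Primrec.const 0) (Primrec.pair (Primrec.const 0) (Primrec.pair
      (Primrec.const []) (Primrec.list_append.comp h222
        (Primrec.list_cons.comp h221 (Primrec.const [])))))
  · exact Primrec.pair (Primrec.const 0) (Primrec.pair (Primrec.const 0) (Primrec.pair
      (Primrec.list_append.comp h221 (Primrec.list_cons.comp h21 (Primrec.const []))) h222))

theorem primrec_decState : Primrec decState :=
  Primrec.snd.comp (Primrec.snd.comp (Primrec.snd.comp (Primrec.list_foldl Primrec.id
    (Primrec.const (0, 0, [], [])) (primrec_decStep.comp (Primrec.fst.comp Primrec.snd)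
      (Primrec.snd.comp Primrec.snd)).to₂)))

theorem primrec_nextDeg {n : α → ℕ} {deg : α → List ℕ} {t : α → Token} (hn : Primrec n)
    (hd : Primrec deg) (ht : Primrec t) : Primrec fun a => nextDeg (n a) (deg a) (t a) :=
  Primrec.list_map (Primrec.list_range.comp hn) (Primrec.nat_add.comp
    (primrec_getD 0 (hd.comp Primrec.fst) Primrec.snd)
    (primrec_degree ((Primrec.optionToList.comp ht).comp Primrec.fst) Primrec.snd))

theorem primrec_coreStep {n : α → ℕ} {deg R : α → List ℕ} {buf : α → List Edge} {t : α → Token}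
    {r : α → List Bool} (hn : Primrec n) (hd : Primrec deg) (hR : Primrec R) (hb : Primrec buf)
    (ht : Primrec t) (hr : Primrec r) :
    Primrec fun a => coreStep (n a) (deg a) (R a) (buf a) (t a) (r a) := by
  have ht' := Primrec.optionToList.comp ht
  have hb' := Primrec.list_append.comp hb ht'
  have hd' := primrec_nextDeg hn hd ht
  have hR' : Primrec fun a => nextMask (deg a) (nextDeg (n a) (deg a) (t a)) (R a) (r a) :=
    Primrec.ite (Primrec.eq.comp (primrec_phase hd) (primrec_phase hd')) hR
      (Primrec.list_map hr (Primrec.ite (Primrec.eq.comp Primrec.snd (Primrec.const true))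
        (Primrec.const 1) (Primrec.const 0)))
  have henc : ∀ {l : α → List ℕ}, Primrec l → Primrec fun a =>
      encState [nextDeg (n a) (deg a) (t a),
        nextMask (deg a) (nextDeg (n a) (deg a) (t a)) (R a) (r a), l a] := fun hl =>
    primrec_encState.comp (Primrec.list_cons.comp hd' (Primrec.list_cons.comp hR'
      (Primrec.list_cons.comp hl (Primrec.const []))))
  have hcap : Primrec fun a => capacity (n a) :=
    Primrec.nat_mul.comp hn (primrec_pow (primrec_size hn) (Primrec.const 2))
  refine Primrec.ite ((Primrec.eq.comp ht' (Primrec.const [])).or (Primrec.nat_le.comp hcap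
    (Primrec.list_length.comp hb'))) ?_ ?_
  · exact Primrec.pair (henc (Primrec.const [])) (primrec_colorBatch hn hd' hR' hb')
  · exact Primrec.pair (henc (Primrec.list_map hb' (Primrec₂.natPair.comp
      (Primrec.fst.comp Primrec.snd) (Primrec.snd.comp Primrec.snd)))) (Primrec.const [])

end Computability

/-- The degrees stored in the memory. -/
def memDeg (m : Mem) : List ℕ := (decState m).getD 0 []

/-- The random bits stored in the memory. -/
def memMask (m : Mem) : List ℕ := (decState m).getD 1 []

/-- The buffered edges stored in the memory. -/
def memBuf (m : Mem) : List Edge := ((decState m).getD 2 []).map Nat.unpair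

/-- The edge coloring algorithm. -/
def edgeColoring : Algorithm where
  init n := encState [(List.range n).map fun _ => 0, [], []]
  coins n m t := n * phase (nextDeg n (memDeg m) t)
  step n m t r := coreStep n (memDeg m) (memMask m) (memBuf m) t r
  computable_init :=
    (primrec_encState.comp (Primrec.list_cons.comp (Primrec.list_map Primrec.list_range
      (Primrec.const 0).to₂) (Primrec.const _))).to_comp
  computable_coins := by
    have hm : Primrec fun x : ℕ × Mem × Token => x.2.1 := Primrec.fst.comp Primrec.snd
    exact (Primrec.nat_mul.comp Primrec.fst (primrec_phase (primrec_nextDeg Primrec.fst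
      (primrec_getD [] (primrec_decState.comp hm) (Primrec.const 0))
      (Primrec.snd.comp Primrec.snd)))).to_comp
  computable_step := by
    have hm : Primrec fun x : ℕ × Mem × Token × List Bool => x.2.1 := Primrec.fst.comp Primrec.snd
    have hd := primrec_decState.comp hm
    exact (primrec_coreStep Primrec.fst (primrec_getD [] hd (Primrec.const 0))
      (primrec_getD [] hd (Primrec.const 1))
      (Primrec.list_map (primrec_getD [] hd (Primrec.const 2))
        (Primrec.unpair.comp Primrec.snd).to₂)
      (Primrec.fst.comp (Primrec.snd.comp Primrec.snd))
      (Primrec.snd.comp (Primrec.snd.comp Primrec.snd))).to_comp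

/-! ### The memory code -/

theorem bitAt_lt_two (x i : ℕ) : bitAt x i < 2 := Nat.mod_lt _ two_pos

theorem testBit_eq_bitAt (x i : ℕ) : x.testBit i = decide (bitAt x i = 1) :=
  Nat.testBit_eq_decide_div_mod_eq

theorem bitAt_eq_bitAt_iff {x y i j : ℕ} :
    bitAt x i = bitAt y j ↔ x.testBit i = y.testBit j := by
  have h1 := bitAt_lt_two x i
  have h2 := bitAt_lt_two y j
  rw [testBit_eq_bitAt, testBit_eq_bitAt, decide_eq_decide]
  omega

/-- Horner's scheme, with an arbitrary accumulator for the sake of the induction. -/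
theorem foldl_digits (x k c : ℕ) :
    ((List.range k).reverse.map (bitAt x)).foldl (fun c d => 2 * c + d) c =
      c * 2 ^ k + x % 2 ^ k := by
  induction k generalizing c with
  | zero => simp [Nat.mod_one]
  | succ k ih =>
    rw [List.range_succ, List.reverse_append]
    simp only [List.reverse_cons, List.reverse_nil, List.nil_append, List.singleton_append,
      List.map_cons, List.foldl_cons]
    rw [ih, Nat.mod_pow_succ, bitAt]
    ring

theorem foldl_digitsMSB (x : ℕ) : (digitsMSB x).foldl (fun c d => 2 * c + d) 0 = x := by
  rw [digitsMSB, foldl_digits, Nat.mod_eq_of_lt (Nat.lt_size_self x)]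
  simp

theorem foldl_decStep_digits (ds : List ℕ) (hd : ∀ d ∈ ds, d < 2) (c : ℕ) (ns : List ℕ)
    (ls : List (List ℕ)) :
    (ds.flatMap fun b => [false, decide (b = 1)]).foldl decStep (0, c, ns, ls) =
      (0, ds.foldl (fun c d => 2 * c + d) c, ns, ls) := by
  induction ds generalizing c with
  | nil => rfl
  | cons d ds ih =>
    have h : (if d = 1 then 1 else 0) = d := by
      have := hd d (by simp)
      split_ifs <;> omega
    have h2 : [false, decide (d = 1)].foldl decStep (0, c, ns, ls) = (0, 2 * c + d, ns, ls) := by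
      simp [decStep, h]
    rw [List.flatMap_cons, List.foldl_append, h2, List.foldl_cons,
      ih fun d hd' => hd d (List.mem_cons_of_mem _ hd')]

theorem foldl_decStep_encNum (x : ℕ) (ns : List ℕ) (ls : List (List ℕ)) :
    (encNum x).foldl decStep (0, 0, ns, ls) = (0, 0, ns ++ [x], ls) := by
  have h : ∀ d ∈ digitsMSB x, d < 2 := by
    intro d hd
    obtain ⟨i, _, rfl⟩ := List.mem_map.1 hd
    exact bitAt_lt_two x i
  rw [encNum, List.foldl_append, foldl_decStep_digits _ h, foldl_digitsMSB]
  simp [decStep]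

theorem foldl_decStep_encList (l : List ℕ) (ls : List (List ℕ)) :
    (encList l).foldl decStep (0, 0, [], ls) = (0, 0, [], ls ++ [l]) := by
  have h : ∀ ns, (l.flatMap encNum).foldl decStep (0, 0, ns, ls) = (0, 0, ns ++ l, ls) := by
    induction l with
    | nil => simp
    | cons x l ih =>
      intro ns
      rw [List.flatMap_cons, List.foldl_append, foldl_decStep_encNum, ih]
      simp
  rw [encList, List.foldl_append, h]
  simp [decStep]

/-- The code is read in pairs of bits: `false, b` is a digit, `true, false` ends a number, `true,
true` ends a list. The decoder therefore never has to look ahead, and after each complete list it is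
back in its initial state except for the lists collected. -/
theorem decState_encState (L : List (List ℕ)) : decState (encState L) = L := by
  have h : ∀ ls, (encState L).foldl decStep (0, 0, [], ls) = (0, 0, [], ls ++ L) := by
    induction L with
    | nil => simp [encState]
    | cons l L ih =>
      intro ls
      rw [encState, List.flatMap_cons, List.foldl_append, foldl_decStep_encList]
      exact (ih _).trans (by simp)
  rw [decState, h]
  simp

theorem length_encNum (x : ℕ) : (encNum x).length = 2 * x.size + 2 := by
  simp [encNum, digitsMSB, List.length_flatMap, Function.comp_def]
  ring

theorem length_encList_le {l : List ℕ} {b : ℕ} (h : ∀ x ∈ l, x.size ≤ b) :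
    (encList l).length ≤ l.length * (2 * b + 2) + 2 := by
  rw [encList, List.length_append, List.length_flatMap]
  simp only [length_encNum, List.length_cons, List.length_nil]
  have : (l.map fun x => 2 * x.size + 2).sum ≤ (l.map fun x => 2 * x.size + 2).length • (2 * b + 2) :=
    List.sum_le_card_nsmul _ _ (by
      intro y hy
      obtain ⟨x, hx, rfl⟩ := List.mem_map.1 hy
      have := h x hx
      omega)
  rw [List.length_map, smul_eq_mul] at this
  omega

/-! ### Degrees -/

theorem degree_append (s t : List Edge) (v : ℕ) : degree (s ++ t) v = degree s v + degree t v := by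
  simp [degree]

theorem degree_singleton (e : Edge) (v : ℕ) :
    degree [e] v = if e.1 = v ∨ e.2 = v then 1 else 0 := by
  simp [degree, List.countP_cons]

theorem degree_le_of_prefix {s t : List Edge} (h : s <+: t) (v : ℕ) : degree s v ≤ degree t v := by
  obtain ⟨r, rfl⟩ := h
  rw [degree_append]
  omega

theorem degree_le_maxDegree {n v : ℕ} (s : List Edge) (hv : v < n) : degree s v ≤ maxDegree n s :=
  Finset.le_sup (f := degree s) (Finset.mem_range.2 hv)

/-- The list of the degrees of the vertices `0, …, n - 1`. -/
def degList (n : ℕ) (s : List Edge) : List ℕ := (List.range n).map (degree s)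

theorem degList_getD {n v : ℕ} (s : List Edge) (hv : v < n) : (degList n s).getD v 0 = degree s v := by
  simp [degList, List.getD, hv]

theorem nextDeg_degList (n : ℕ) (s : List Edge) (t : Token) :
    nextDeg n (degList n s) t = degList n (s ++ t.toList) := by
  refine List.map_congr_left fun v hv => ?_
  rw [degList_getD s (List.mem_range.1 hv), degree_append]

theorem listMax_map_range (n : ℕ) (f : ℕ → ℕ) :
    listMax ((List.range n).map f) = (Finset.range n).sup f := by
  have h : ∀ l : List ℕ, listMax (l.map f) = l.toFinset.sup f := by
    intro l
    induction l with
    | nil => rfl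
    | cons a l ih =>
      rw [List.toFinset_cons, Finset.sup_insert, ← ih]
      rfl
  rw [h, List.toFinset_range]

theorem phase_degList (n : ℕ) (s : List Edge) : phase (degList n s) = (maxDegree n s).size := by
  rw [phase, degList, listMax_map_range]
  rfl

theorem degree_lt_two_pow_phase {n v : ℕ} (s : List Edge) (hv : v < n) :
    degree s v < 2 ^ phase (degList n s) := by
  rw [phase_degList]
  exact (degree_le_maxDegree s hv).trans_lt (Nat.lt_size_self _)

theorem maxDegree_mono {s t : List Edge} (n : ℕ) (h : s <+: t) : maxDegree n s ≤ maxDegree n t :=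
  Finset.sup_mono_fun fun v _ => degree_le_of_prefix h v

theorem phase_mono {s t : List Edge} (n : ℕ) (h : s <+: t) :
    phase (degList n s) ≤ phase (degList n t) := by
  rw [phase_degList, phase_degList]
  exact Nat.size_le_size (maxDegree_mono n h)

theorem sum_degree {n : ℕ} {s : List Edge} (hs : IsEdgeStream n s) :
    ∑ v ∈ Finset.range n, degree s v = 2 * s.length := by
  induction s with
  | nil => simp [degree]
  | cons e s ih =>
    have he := hs e (by simp)
    have h : ∀ v, degree (e :: s) v =
        ((if e.1 = v then 1 else 0) + (if e.2 = v then 1 else 0)) + degree s v := by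
      intro v
      rw [← List.singleton_append, degree_append, degree_singleton]
      have : ¬ (e.1 = v ∧ e.2 = v) := fun h => he.2.2 (h.1.trans h.2.symm)
      split_ifs <;> tauto
    simp only [h, Finset.sum_add_distrib, ih fun f hf => hs f (List.mem_cons_of_mem _ hf),
      Finset.sum_ite_eq, Finset.mem_range, he.1, he.2.1, if_true, List.length_cons]
    ring

/-- The handshake lemma: the stored degrees alone reveal the number of edges read, which serves as
the name of a batch. -/
theorem sum_degList {n : ℕ} {s : List Edge} (hs : IsEdgeStream n s) :
    (degList n s).sum = 2 * s.length := by
  rw [← sum_degree hs, degList]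
  rfl

theorem two_mul_length_le {n : ℕ} {s : List Edge} (hs : IsEdgeStream n s) :
    2 * s.length ≤ n * maxDegree n s := by
  rw [← sum_degree hs]
  refine (Finset.sum_le_card_nsmul _ _ _ fun v hv =>
    degree_le_maxDegree s (Finset.mem_range.1 hv)).trans ?_
  simp

theorem IsEdgeStream.of_prefix {n : ℕ} {s t : List Edge} (ht : IsEdgeStream n t) (h : s <+: t) :
    IsEdgeStream n s := fun e he => ht e (h.subset he)

/-- Two edges of a list with a common endpoint are at the same position if they have the same rank
at this endpoint. -/
theorem eq_of_rank_eq {b p₁ p₂ : List Edge} {e₁ e₂ : Edge} {v : ℕ} (h₁ : p₁ ++ [e₁] <+: b)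
    (h₂ : p₂ ++ [e₂] <+: b) (hv₁ : e₁.1 = v ∨ e₁.2 = v) (hv₂ : e₂.1 = v ∨ e₂.2 = v)
    (h : degree p₁ v = degree p₂ v) : p₁ = p₂ := by
  have key : ∀ {p₁ p₂ : List Edge} {e₁ e₂ : Edge}, p₁ ++ [e₁] <+: b → p₂ ++ [e₂] <+: b →
      (e₁.1 = v ∨ e₁.2 = v) → degree p₁ v = degree p₂ v → p₂.length ≤ p₁.length := by
    intro p₁ p₂ e₁ e₂ h₁ h₂ hv h
    by_contra! hlt
    have h3 : p₁ ++ [e₁] <+: p₂ := List.prefix_of_prefix_length_le h₁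
      ((List.prefix_append _ _).trans h₂) (by simpa using hlt)
    have h4 := degree_le_of_prefix h3 v
    rw [degree_append, degree_singleton, if_pos hv] at h4
    omega
  have hl := le_antisymm (key h₂ h₁ hv₂ h.symm) (key h₁ h₂ hv₁ h)
  exact (List.prefix_of_prefix_length_le ((List.prefix_append _ _).trans h₁)
    ((List.prefix_append _ _).trans h₂) hl.le).eq_of_length hl

/-! ### Sides and masks -/

theorem findIdx_range_spec {m : ℕ} {p : ℕ → Bool} (h : (List.range m).findIdx p < m) :
    p ((List.range m).findIdx p) = true := by
  have h2 := List.findIdx_getElem (xs := List.range m) (p := p) (w := by simpa using h)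
  rwa [List.getElem_range] at h2

theorem exists_bitAt_ne {u v m : ℕ} (h : u ≠ v) (hu : u < 2 ^ m) (hv : v < 2 ^ m) :
    ∃ i < m, bitAt u i ≠ bitAt v i := by
  by_contra! hc
  refine h (Nat.eq_of_testBit_eq fun i => ?_)
  rcases lt_or_ge i m with hi | hi
  · exact bitAt_eq_bitAt_iff.1 (hc i hi)
  · have h2 : 2 ^ m ≤ 2 ^ i := Nat.pow_le_pow_right two_pos hi
    rw [Nat.testBit_lt_two_pow (hu.trans_le h2), Nat.testBit_lt_two_pow (hv.trans_le h2)]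

theorem splitLevel_le {u v i : ℕ} (h : bitAt u i ≠ bitAt v i) :
    splitLevel u v ≤ i := by
  by_contra! hlt
  have := List.not_of_lt_findIdx hlt
  simp at this
  exact h this

theorem exists_splitLevel {u v : ℕ} (h : u ≠ v) : ∃ i < u + v, bitAt u i ≠ bitAt v i := by
  obtain ⟨i, hi, h2⟩ := exists_bitAt_ne h (m := max u v)
    (Nat.lt_two_pow_self.trans_le (Nat.pow_le_pow_right two_pos (le_max_left u v)))
    (Nat.lt_two_pow_self.trans_le (Nat.pow_le_pow_right two_pos (le_max_right u v)))
  exact ⟨i, hi.trans_le (max_le (by omega) (by omega)), h2⟩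

theorem bitAt_splitLevel_ne {u v : ℕ} (h : u ≠ v) :
    bitAt u (splitLevel u v) ≠ bitAt v (splitLevel u v) := by
  obtain ⟨i, hi, h2⟩ := exists_splitLevel h
  have h3 : splitLevel u v < u + v := (splitLevel_le h2).trans_lt hi
  exact of_decide_eq_true (findIdx_range_spec h3)

theorem side_lt {n u v : ℕ} (h : u ≠ v) (hu : u < n) (hv : v < n) : side u v < 2 * n.size := by
  have hn := Nat.lt_size_self n
  obtain ⟨i, hi, h2⟩ := exists_bitAt_ne h (hu.trans hn) (hv.trans hn)
  have h3 := splitLevel_le h2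
  have := bitAt_lt_two u (splitLevel u v)
  rw [side]
  omega

/-- Equal labels would mean the same splitting level with `u` and `v` having the same bit there, yet
that level is one where `u` and `v` differ. -/
theorem side_ne {u v w : ℕ} (h : u ≠ v) : side u v ≠ side v w := by
  intro he
  have h1 := bitAt_lt_two u (splitLevel u v)
  have h2 := bitAt_lt_two v (splitLevel v w)
  rw [side, side] at he
  have h3 : splitLevel u v = splitLevel v w := by omega
  have h4 := bitAt_splitLevel_ne h
  rw [← h3] at he h2
  omega

/-- Adding a fixed bit modulo 2 in each position is a bijection, so masking loses nothing at a fixed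
vertex, whatever `R` is. -/
theorem maskBits_inj {p : ℕ} {R : List ℕ} {v c d : ℕ} (hc : c < 2 ^ p) (hd : d < 2 ^ p)
    (h : maskBits p R v c = maskBits p R v d) : c = d := by
  by_contra hne
  obtain ⟨i, hi, h2⟩ := exists_bitAt_ne hne hc hd
  have h3 := List.map_inj_left.1 h i (List.mem_range.2 hi)
  have := bitAt_lt_two c i
  have := bitAt_lt_two d i
  omega

/-! ### Greedy colors -/

/-- Pigeonhole: more candidate indices than used colors, and the encoding is injective. -/
theorem exists_fresh (used κ : List ℕ) :
    ∃ g < used.length + 1, encode (g :: κ) ∉ used := by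
  by_contra! h
  have h1 : ((Finset.range (used.length + 1)).image fun g => encode (g :: κ)) ⊆ used.toFinset := by
    intro x hx
    obtain ⟨g, hg, rfl⟩ := Finset.mem_image.1 hx
    exact List.mem_toFinset.2 (h g (Finset.mem_range.1 hg))
  have h2 := Finset.card_le_card h1
  rw [Finset.card_image_of_injective _ fun a b hab => by simpa using hab, Finset.card_range] at h2
  have := used.toFinset_card_le
  omega

theorem freshIndex_lt (used κ : List ℕ) : freshIndex used κ < used.length + 1 := by
  obtain ⟨g, hg, h⟩ := exists_fresh used κ
  rw [freshIndex]
  refine (List.findIdx_lt_length_of_exists ⟨g, List.mem_range.2 hg, decide_eq_true h⟩).trans_eq ?_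
  simp

theorem freshIndex_notMem (used κ : List ℕ) : encode (freshIndex used κ :: κ) ∉ used := by
  exact of_decide_eq_true (findIdx_range_spec (freshIndex_lt used κ))

theorem mem_of_lt_freshIndex {used κ : List ℕ} {g : ℕ} (h : g < freshIndex used κ) :
    encode (g :: κ) ∈ used := by
  have := List.not_of_lt_findIdx h
  simpa using this

/-! ### The coloring of a batch -/

theorem exists_mem_undirected_iff (e f : Edge) :
    (∃ v, v ∈ e.undirected ∧ v ∈ f.undirected) ↔ Adj e f := by
  simp only [Edge.undirected, Sym2.mem_iff, Adj]
  constructor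
  · rintro ⟨v, rfl | rfl, h | h⟩ <;> simp [h]
  · rintro (h | h | h | h)
    exacts [⟨e.1, by simp [h]⟩, ⟨e.1, by simp [h]⟩, ⟨e.2, by simp [h]⟩, ⟨e.2, by simp [h]⟩]

/-- The color of the edge `e` of the batch `buf` in which it is preceded by `pre`. -/
def batchColor (n : ℕ) (deg R : List ℕ) (buf pre : List Edge) (e : Edge) : ℕ :=
  freshIndex (usedColors (pre.foldl (colorStep n deg R buf) []) e) (key n deg R buf pre e)

section Batch

variable {n : ℕ} {deg R : List ℕ} {buf : List Edge}

theorem map_fst_foldl_colorStep (pre : List Edge) :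
    (pre.foldl (colorStep n deg R buf) []).map Prod.fst = pre := by
  induction pre using List.reverseRecOn with
  | nil => rfl
  | append_singleton pre e ih =>
    rw [List.foldl_append, List.foldl_cons, List.foldl_nil, colorStep, List.map_append, ih]
    rfl

theorem foldl_colorStep_concat (pre : List Edge) (e : Edge) :
    (pre ++ [e]).foldl (colorStep n deg R buf) [] = pre.foldl (colorStep n deg R buf) [] ++
      [(e, encode (batchColor n deg R buf pre e :: key n deg R buf pre e))] := by
  rw [List.foldl_append, List.foldl_cons, List.foldl_nil, colorStep, map_fst_foldl_colorStep]
  rfl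

theorem map_fst_colorBatch : (colorBatch n deg R buf).map Prod.fst = buf :=
  map_fst_foldl_colorStep buf

theorem mem_foldl_colorStep {pre : List Edge} {o : Out}
    (h : o ∈ pre.foldl (colorStep n deg R buf) []) :
    ∃ q, q ++ [o.1] <+: pre ∧
      o.2 = encode (batchColor n deg R buf q o.1 :: key n deg R buf q o.1) := by
  induction pre using List.reverseRecOn with
  | nil => simp at h
  | append_singleton pre e ih =>
    rw [foldl_colorStep_concat, List.mem_append, List.mem_singleton] at h
    rcases h with h | rfl
    · obtain ⟨q, hq, hc⟩ := ih h
      exact ⟨q, hq.trans (List.prefix_append _ _), hc⟩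
    · exact ⟨pre, List.prefix_rfl, rfl⟩

theorem pairwise_foldl_colorStep (pre : List Edge) :
    (pre.foldl (colorStep n deg R buf) []).Pairwise fun a b => Adj a.1 b.1 → a.2 ≠ b.2 := by
  induction pre using List.reverseRecOn with
  | nil => exact List.Pairwise.nil
  | append_singleton pre e ih =>
    rw [foldl_colorStep_concat, List.pairwise_append]
    refine ⟨ih, List.pairwise_singleton _ _, fun a ha b hb hab heq => ?_⟩
    obtain rfl := List.mem_singleton.1 hb
    refine freshIndex_notMem (usedColors (pre.foldl (colorStep n deg R buf) []) e)
      (key n deg R buf pre e) ?_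
    exact List.mem_map.2 ⟨a, List.mem_filter.2 ⟨ha, decide_eq_true hab⟩, heq⟩

/-- The greedy index is at most the number of earlier adjacent edges. This is the bound used when
both batch degrees are low. -/
theorem batchColor_le_degree (pre : List Edge) (e : Edge) :
    batchColor n deg R buf pre e ≤ degree pre e.1 + degree pre e.2 := by
  have h1 : ∀ l : List Out, (l.filter fun o => Adj o.1 e).length ≤
      degree (l.map Prod.fst) e.1 + degree (l.map Prod.fst) e.2 := by
    intro l
    induction l with
    | nil => simp
    | cons o l ih =>
      rw [List.map_cons, ← List.singleton_append (x := o.1), degree_append, degree_append,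
        degree_singleton, degree_singleton, List.filter_cons]
      by_cases h : Adj o.1 e
      · have : o.1.1 = e.1 ∨ o.1.2 = e.1 ∨ o.1.1 = e.2 ∨ o.1.2 = e.2 := by
          unfold Adj at h; tauto
        simp only [h, decide_true, if_true, List.length_cons]
        split_ifs <;> omega
      · simp only [h, decide_false, Bool.false_eq_true, if_false]
        omega
  have h2 := freshIndex_lt (usedColors (pre.foldl (colorStep n deg R buf) []) e)
    (key n deg R buf pre e)
  have h3 := h1 (pre.foldl (colorStep n deg R buf) [])
  rw [map_fst_foldl_colorStep] at h3
  rw [batchColor]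
  refine (Nat.lt_succ_iff.1 h2).trans ?_
  rw [usedColors, List.length_map]
  exact h3

end Batch

/-! ### Edges with a center of high batch degree. -/

theorem threshold_pos {n : ℕ} (hn : 0 < n) (p : ℕ) : 0 < threshold n p :=
  Nat.mul_pos (by positivity) (pow_pos (Nat.size_pos.2 hn) 2)

/-- The key of an edge with center `o.1` of high batch degree and with leaf `o.2`, in terms of the
edges `d` before the batch. -/
def starKey (n p : ℕ) (R : List ℕ) (d b q : List Edge) (o : Edge) : List ℕ :=
  [p, side o.1 o.2, degree (d ++ b) o.1 / threshold n p,
    encode (maskBits p R o.2 (degree d o.2 + degree q o.2))]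

/-- The pairs (leaf, rank at the leaf) of the edges of the batch `b` at the vertex `u`. -/
noncomputable def starPairs (n p : ℕ) (d b : List Edge) (u : ℕ) : Finset (ℕ × ℕ) := by
  classical
  exact (Finset.range n ×ˢ Finset.range (2 ^ p)).filter fun x =>
    ∃ q e, q ++ [e] <+: b ∧ (e = (u, x.1) ∨ e = (x.1, u)) ∧ x.2 = degree d x.1 + degree q x.1

theorem prefix_concat_inj {α : Type*} {b q : List α} {e f : α} (h : q ++ [e] <+: b)
    (h' : q ++ [f] <+: b) : e = f := by
  have := (List.prefix_of_prefix_length_le h h' (by simp)).eq_of_length (by simp)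
  simpa using this

/-- Each pair comes from an edge of the batch at `u`, and the rank of that edge at `u` determines
the edge and with it the pair. -/
theorem card_starPairs_le (n p : ℕ) (d b : List Edge) (u : ℕ) :
    (starPairs n p d b u).card ≤ degree b u := by
  classical
  have h : ∀ x ∈ starPairs n p d b u, ∃ q e, q ++ [e] <+: b ∧ (e = (u, x.1) ∨ e = (x.1, u)) ∧
      x.2 = degree d x.1 + degree q x.1 := fun x hx => (Finset.mem_filter.1 hx).2
  choose! q e hq he hc using h
  have hu : ∀ x ∈ starPairs n p d b u, (e x).1 = u ∨ (e x).2 = u := by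
    intro x hx
    rcases he x hx with h | h <;> simp [h]
  rw [← Finset.card_range (degree b u)]
  refine Finset.card_le_card_of_injOn (fun x => degree (q x) u) (fun x hx => ?_) ?_
  · have h1 := degree_le_of_prefix (hq x hx) u
    rw [degree_append, degree_singleton, if_pos (hu x hx)] at h1
    simpa using h1
  · intro x hx y hy hxy
    have h1 : q x = q y := eq_of_rank_eq (hq x hx) (hq y hy) (hu x hx) (hu y hy) hxy
    have h2 : e x = e y := prefix_concat_inj (hq x hx) (h1 ▸ hq y hy)
    have h3 : x.1 = y.1 := by
      rcases he x hx with h | h <;> rcases he y hy with h' | h' <;>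
        rw [h, h', Prod.mk.injEq] at h2 <;> omega
    exact Prod.ext h3 (by rw [hc x hx, hc y hy, h1, h3])

theorem key_cases {n : ℕ} {R : List ℕ} {d b q : List Edge} {e : Edge}
    (hs : IsEdgeStream n (d ++ b)) (hq : q ++ [e] <+: b) :
    (key n (degList n (d ++ b)) R b q e = [2 * (d ++ b).length] ∧
      degree b e.1 ≤ threshold n (phase (degList n (d ++ b))) ∧
      degree b e.2 ≤ threshold n (phase (degList n (d ++ b)))) ∨
    ∃ o, (o = e ∨ o = e.swap) ∧ threshold n (phase (degList n (d ++ b))) < degree b o.1 ∧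
      key n (degList n (d ++ b)) R b q e =
        starKey n (phase (degList n (d ++ b))) R d b q o := by
  have he := hs e (List.mem_append_right _ (hq.subset (by simp)))
  rw [key]
  split_ifs with h
  · exact Or.inl ⟨by rw [sum_degList hs], h⟩
  · refine Or.inr ⟨direct (threshold n (phase (degList n (d ++ b)))) b e, ?_, ?_, ?_⟩
    · rw [direct]
      split_ifs <;> simp
    · rw [direct]
      split_ifs with h2
      · exact h2
      · exact not_le.1 fun h3 => h ⟨not_lt.1 h2, h3⟩
    · have ho : (direct (threshold n (phase (degList n (d ++ b)))) b e).1 < n ∧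
          (direct (threshold n (phase (degList n (d ++ b)))) b e).2 < n := by
        rw [direct]
        split_ifs
        exacts [⟨he.1, he.2.1⟩, ⟨he.2.1, he.1⟩]
      -- The stored degrees already include the batch; subtracting the batch degree of the leaf
      -- recovers its degree before the batch, to which the rank inside the batch is added.
      rw [highKey, starKey, degList_getD _ ho.1, degList_getD _ ho.2, degree_append d b,
        degree_append d b, Nat.add_sub_cancel]

theorem adj_of_orient {e f o o' : Edge} (ho : o = e ∨ o = e.swap) (ho' : o' = f ∨ o' = f.swap)
    (h : Adj e f) : Adj o o' := by
  unfold Adj at *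
  rcases ho with rfl | rfl <;> rcases ho' with rfl | rfl <;> try simp only [Prod.fst_swap,
    Prod.snd_swap]
  all_goals tauto

/-- Two directed edges with the same side label that have a common endpoint have a common center or
a common leaf. -/
theorem center_or_leaf_eq {o o' : Edge} (h : Adj o o') (hs : side o.1 o.2 = side o'.1 o'.2)
    (ho : o.1 ≠ o.2) (ho' : o'.1 ≠ o'.2) : o.1 = o'.1 ∨ o.2 = o'.2 := by
  rcases h with h | h | h | h
  · exact Or.inl h
  · rw [h] at hs
    exact absurd hs.symm (side_ne ho')
  · rw [← h] at hs
    exact absurd hs (side_ne ho)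
  · exact Or.inr h

/-- Every index below the greedy one is blocked by an earlier adjacent edge with the same key. Equal
labels leave a common center or a common leaf, and a common leaf is excluded by the ranks. So the
blocking edges are edges at the same center whose masked ranks agree, and distinct indices give
distinct pairs (leaf, rank). -/
theorem batchColor_le_card {n : ℕ} {R : List ℕ} {d b q : List Edge} {e o : Edge}
    (hs : IsEdgeStream n (d ++ b)) (hq : q ++ [e] <+: b) (ho : o = e ∨ o = e.swap)
    (hk : key n (degList n (d ++ b)) R b q e = starKey n (phase (degList n (d ++ b))) R d b q o) :
    batchColor n (degList n (d ++ b)) R b q e ≤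
      ((starPairs n (phase (degList n (d ++ b))) d b o.1).filter fun x =>
        maskBits (phase (degList n (d ++ b))) R x.1 x.2 =
          maskBits (phase (degList n (d ++ b))) R o.2 (degree d o.2 + degree q o.2)).card := by
  classical
  set deg := degList n (d ++ b) with hdeg
  set p := phase deg with hp
  have hne : ∀ {q e o}, q ++ [e] <+: b → (o = e ∨ o = e.swap) → o.1 < n ∧ o.2 < n ∧ o.1 ≠ o.2 := by
    intro q e o hq ho
    have he := hs e (List.mem_append_right _ (hq.subset (by simp)))
    rcases ho with rfl | rfl
    exacts [he, ⟨he.2.1, he.1, he.2.2.symm⟩]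
  have hlt : ∀ {q e o}, q ++ [e] <+: b → (o = e ∨ o = e.swap) →
      degree d o.2 + degree q o.2 < 2 ^ p := by
    intro q e o hq ho
    have h1 := degree_lt_two_pow_phase (d ++ b) (hne hq ho).2.1
    have h2 := degree_le_of_prefix ((List.prefix_append q _).trans hq) o.2
    rw [degree_append, ← hdeg, ← hp] at h1
    omega
  have hmem : ∀ g < batchColor n deg R b q e, ∃ q' e' o', q' ++ [e'] <+: q ∧
      (o' = e' ∨ o' = e'.swap) ∧ o'.1 = o.1 ∧
      maskBits p R o'.2 (degree d o'.2 + degree q' o'.2) =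
        maskBits p R o.2 (degree d o.2 + degree q o.2) ∧ batchColor n deg R b q' e' = g := by
    intro g hg
    obtain ⟨r, hr, hrc⟩ := List.mem_map.1 (mem_of_lt_freshIndex hg)
    obtain ⟨hr, hadj⟩ := List.mem_filter.1 hr
    obtain ⟨q', hq', hc⟩ := mem_foldl_colorStep hr
    rw [hrc] at hc
    obtain ⟨hg', hκ⟩ := List.cons.inj (encode_injective hc)
    have hq'b : q' ++ [r.1] <+: b := hq'.trans ((List.prefix_append _ _).trans hq)
    rcases key_cases (R := R) hs hq'b with ⟨h, -⟩ | ⟨o', ho', -, h⟩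
    · rw [hk, h] at hκ
      simp [starKey] at hκ
    · rw [hk, h, ← hdeg, ← hp, starKey, starKey] at hκ
      simp only [List.cons.injEq, true_and, and_true] at hκ
      refine ⟨q', r.1, o', hq', ho', ?_, (encode_injective hκ.2.2).symm, hg'.symm⟩
      rcases center_or_leaf_eq (adj_of_orient ho' ho (of_decide_eq_true hadj)) hκ.1.symm
        (hne hq'b ho').2.2 (hne hq ho).2.2 with h2 | h2
      · exact h2
      -- With a common leaf, unmasking shows equal ranks there, but the earlier edge already counts
      -- toward the rank of the later one.
      · have h3 := encode_injective hκ.2.2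
        rw [h2] at h3
        have h4 := maskBits_inj (hlt hq ho) (h2 ▸ hlt hq'b ho') h3
        have h5 := degree_le_of_prefix hq' o.2
        have h6 : r.1.1 = o.2 ∨ r.1.2 = o.2 := by
          rw [← h2]
          rcases ho' with rfl | rfl <;> simp
        rw [degree_append, degree_singleton, if_pos h6] at h5
        omega
  choose! q' e' o' hq' ho' hu hm hg using hmem
  have hb : ∀ g < batchColor n deg R b q e, q' g ++ [e' g] <+: b := fun g h =>
    (hq' g h).trans ((List.prefix_append _ _).trans hq)
  rw [← Finset.card_range (batchColor n deg R b q e)]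
  refine Finset.card_le_card_of_injOn
    (fun g => ((o' g).2, degree d (o' g).2 + degree (q' g) (o' g).2)) (fun g h => ?_) ?_
  · have h := Finset.mem_range.1 h
    refine Finset.mem_filter.2 ⟨Finset.mem_filter.2 ⟨Finset.mem_product.2
      ⟨Finset.mem_range.2 (hne (hb g h) (ho' g h)).2.1,
        Finset.mem_range.2 (hlt (hb g h) (ho' g h))⟩, q' g, e' g, hb g h, ?_, rfl⟩, hm g h⟩
    rw [← hu g h]
    rcases ho' g h with h2 | h2
    · left
      rw [← h2]
    · right
      exact (Prod.swap_swap _).symm.trans (congrArg Prod.swap h2.symm)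
  -- A leaf and a rank at it determine an edge of the batch, hence its greedy index.
  · intro g h g' h' heq
    have h := Finset.mem_range.1 h
    have h' := Finset.mem_range.1 h'
    obtain ⟨h1, h2⟩ := Prod.mk.inj heq
    rw [h1, Nat.add_left_cancel_iff] at h2
    have hv : (e' g).1 = (o' g').2 ∨ (e' g).2 = (o' g').2 := by
      rw [← h1]
      rcases ho' g h with h3 | h3 <;> simp [h3]
    have hv' : (e' g').1 = (o' g').2 ∨ (e' g').2 = (o' g').2 := by
      rcases ho' g' h' with h3 | h3 <;> simp [h3]
    have h3 := eq_of_rank_eq (hb g h) (hb g' h') hv hv' h2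
    have h4 : e' g = e' g' := prefix_concat_inj (hb g h) (h3 ▸ hb g' h')
    rw [← hg g h, ← hg g' h', h3, h4]

/-! ### The invariant of the output -/

/-- What is known about an output record at a time when the edges `d` are colored, the phase is `p`
and the random bits are `R`. -/
def RecordInv (n : ℕ) (d : List Edge) (p : ℕ) (R : List ℕ) (r : Out) : Prop :=
  (∃ g k, r.2 = encode [g, k] ∧ k ≤ 2 * d.length) ∨
  ∃ g p' j α o, (o = r.1 ∨ o = r.1.swap) ∧ o.1 ≠ o.2 ∧
    r.2 = encode [g, p', side o.1 o.2, j, encode α] ∧ p' ≤ p ∧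
    (p' = p → j ≤ degree d o.1 / threshold n p ∧
      ∃ c < degree d o.2, c < 2 ^ p ∧ α = maskBits p R o.2 c)

/-- If the phase advances, the clause on records of the current phase becomes vacuous for the old
ones; if it does not, the mask is unchanged. This is what makes it safe to discard the old mask. -/
theorem RecordInv.mono_phase {n p p' : ℕ} {d : List Edge} {R R' : List ℕ} {r : Out}
    (h : RecordInv n d p R r) (hp : p ≤ p') (hR : p = p' → R = R') : RecordInv n d p' R' r := by
  rcases h with h | ⟨g, q, j, α, o, h1, h2, h3, h4, h5⟩
  · exact Or.inl h
  · refine Or.inr ⟨g, q, j, α, o, h1, h2, h3, h4.trans hp, fun hq => ?_⟩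
    have hpp : p = p' := le_antisymm hp (hq ▸ h4)
    obtain rfl := hR hpp
    subst hpp
    exact h5 hq

theorem RecordInv.mono_edges {n p : ℕ} {d : List Edge} {R : List ℕ} {r : Out}
    (h : RecordInv n d p R r) (b : List Edge) : RecordInv n (d ++ b) p R r := by
  rcases h with ⟨g, k, h1, h2⟩ | ⟨g, q, j, α, o, h1, h2, h3, h4, h5⟩
  · exact Or.inl ⟨g, k, h1, h2.trans (by simp)⟩
  · refine Or.inr ⟨g, q, j, α, o, h1, h2, h3, h4, fun hq => ?_⟩
    obtain ⟨h6, c, h7, h8⟩ := h5 hq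
    refine ⟨h6.trans (Nat.div_le_div_right ?_), c, h7.trans_le ?_, h8⟩ <;>
    · rw [degree_append]
      omega

/-- The records of a batch `b` that arrives after the edges `d`. -/
theorem mem_colorBatch {n : ℕ} {R : List ℕ} {d b : List Edge} {r : Out}
    (hs : IsEdgeStream n (d ++ b)) (hr : r ∈ colorBatch n (degList n (d ++ b)) R b) :
    ∃ q g, q ++ [r.1] <+: b ∧ ((r.2 = encode [g, 2 * (d ++ b).length] ∧
        g ≤ 2 * threshold n (phase (degList n (d ++ b))) ∧ g ≤ 2 * maxDegree n (d ++ b)) ∨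
      ∃ o, (o = r.1 ∨ o = r.1.swap) ∧
        threshold n (phase (degList n (d ++ b))) < degree b o.1 ∧
        r.2 = encode (g :: starKey n (phase (degList n (d ++ b))) R d b q o) ∧
        g ≤ ((starPairs n (phase (degList n (d ++ b))) d b o.1).filter fun x =>
          maskBits (phase (degList n (d ++ b))) R x.1 x.2 =
            maskBits (phase (degList n (d ++ b))) R o.2 (degree d o.2 + degree q o.2)).card) := by
  obtain ⟨q, hq, hc⟩ := mem_foldl_colorStep hr
  have he := hs r.1 (List.mem_append_right _ (hq.subset (by simp)))
  refine ⟨q, batchColor n (degList n (d ++ b)) R b q r.1, hq, ?_⟩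
  rcases key_cases (R := R) hs hq with ⟨h, h1, h2⟩ | ⟨o, ho, h1, h⟩
  · left
    rw [h] at hc
    have h3 := batchColor_le_degree (n := n) (deg := degList n (d ++ b)) (R := R) (buf := b) q r.1
    have h4 := (List.prefix_append q _).trans hq
    have h5 := degree_le_of_prefix h4 r.1.1
    have h6 := degree_le_of_prefix h4 r.1.2
    have h7 := degree_le_maxDegree (d ++ b) he.1
    have h8 := degree_le_maxDegree (d ++ b) he.2.1
    rw [degree_append] at h7 h8
    exact ⟨hc, by omega, by omega⟩
  · right
    have h2 := batchColor_le_card hs hq ho h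
    rw [h] at hc
    exact ⟨o, ho, h1, hc, h2⟩

theorem orient_bounds {n : ℕ} {s : List Edge} {e o : Edge} (hs : IsEdgeStream n s) (he : e ∈ s)
    (ho : o = e ∨ o = e.swap) : o.1 < n ∧ o.2 < n ∧ o.1 ≠ o.2 := by
  have he := hs e he
  rcases ho with rfl | rfl
  exacts [he, ⟨he.2.1, he.1, he.2.2.symm⟩]

theorem rank_lt {n : ℕ} {d b q : List Edge} {e o : Edge} (hs : IsEdgeStream n (d ++ b))
    (hq : q ++ [e] <+: b) (ho : o = e ∨ o = e.swap) :
    degree d o.2 + degree q o.2 < degree (d ++ b) o.2 ∧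
      degree d o.2 + degree q o.2 < 2 ^ phase (degList n (d ++ b)) := by
  have h6 : e.1 = o.2 ∨ e.2 = o.2 := by rcases ho with rfl | rfl <;> simp
  have h5 := degree_le_of_prefix hq o.2
  rw [degree_append, degree_singleton, if_pos h6] at h5
  have h7 := degree_append d b o.2
  have := degree_lt_two_pow_phase (d ++ b)
    (orient_bounds hs (List.mem_append_right _ (hq.subset (by simp))) ho).2.1
  omega

theorem recordInv_of_mem_colorBatch {n : ℕ} {R : List ℕ} {d b : List Edge} {r : Out}
    (hs : IsEdgeStream n (d ++ b)) (hr : r ∈ colorBatch n (degList n (d ++ b)) R b) :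
    RecordInv n (d ++ b) (phase (degList n (d ++ b))) R r := by
  obtain ⟨q, g, hq, ⟨hc, -⟩ | ⟨o, ho, h1, hc, -⟩⟩ := mem_colorBatch hs hr
  · exact Or.inl ⟨g, _, hc, le_rfl⟩
  · exact Or.inr ⟨g, _, _, _, o, ho,
      (orient_bounds hs (List.mem_append_right _ (hq.subset (by simp))) ho).2.2, hc, le_rfl,
      fun _ => ⟨le_rfl, _, (rank_lt hs hq ho).1, (rank_lt hs hq ho).2, rfl⟩⟩

/-- Properness across batches. `RecordInv` is all that has to be remembered about old colors:
quotients and unmasked ranks of the current phase are bounded by the degrees before the batch, and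
the new key exceeds one of these bounds. -/
theorem RecordInv.color_ne {n : ℕ} (hn : 0 < n) {R : List ℕ} {d b : List Edge} {a r : Out}
    (hs : IsEdgeStream n (d ++ b)) (ha : RecordInv n d (phase (degList n (d ++ b))) R a)
    (hr : r ∈ colorBatch n (degList n (d ++ b)) R b) (hadj : Adj a.1 r.1) : a.2 ≠ r.2 := by
  intro heq
  obtain ⟨q, g, hq, ⟨hc, -⟩ | ⟨o, ho, h1, hc, -⟩⟩ := mem_colorBatch hs hr
  -- A low color carries twice the number of edges read, which strictly exceeds the value in any
  -- earlier low color; low and high colors are lists of different lengths.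
  · rw [hc] at heq
    rcases ha with ⟨g', k, h2, h3⟩ | ⟨g', p', j, α, o', -, -, h2, -⟩
    · have h4 := encode_injective (h2.symm.trans heq)
      have h5 := hq.length_le
      simp only [List.cons.injEq, and_true, List.length_append, List.length_cons,
        List.length_nil] at h4 h5
      omega
    · have h4 := encode_injective (h2.symm.trans heq)
      simp at h4
  · rw [hc] at heq
    rcases ha with ⟨g', k, h2, -⟩ | ⟨g', p', j, α, o', ho', hne', h2, -, h3⟩
    · have h4 := encode_injective (h2.symm.trans heq)
      simp [starKey] at h4
    · have h4 := encode_injective (h2.symm.trans heq)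
      simp only [starKey, List.cons.injEq, and_true] at h4
      obtain ⟨-, hp, hside, hj, hα⟩ := h4
      obtain ⟨h5, c, h6, h7, h8⟩ := h3 hp
      have hob := orient_bounds hs (List.mem_append_right _ (hq.subset (by simp))) ho
      rcases center_or_leaf_eq (adj_of_orient ho' ho hadj) hside hne' hob.2.2 with h9 | h9
      -- Common center: its degree grew by more than the threshold within the batch, so the quotient
      -- increased.
      · rw [hj, h9, degree_append] at h5
        have h10 : (degree d o.1 + threshold n (phase (degList n (d ++ b)))) /
            threshold n (phase (degList n (d ++ b))) ≤
            degree d o.1 / threshold n (phase (degList n (d ++ b))) :=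
          (Nat.div_le_div_right (by omega)).trans h5
        rw [Nat.add_div_right _ (threshold_pos hn _)] at h10
        omega
      -- Common leaf: the old counter lies below the degree before the batch, the new one does not.
      · have h10 := encode_injective hα
        rw [h8, h9] at h10
        have h11 := maskBits_inj h7 (rank_lt hs hq ho).2 h10
        rw [h9] at h6
        omega

/-! ### Random masks -/

/-- Coins as numbers. -/
def coinBits (r : List Bool) : List ℕ := r.map fun b => if b = true then 1 else 0

/-- The `p` low bits of `c`, masked by the bits `y`. -/
def maskRow {p : ℕ} (y : Fin p → Bool) (c : ℕ) : List ℕ :=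
  List.ofFn fun i : Fin p => (bitAt c i + if y i = true then 1 else 0) % 2

theorem maskRow_inj_left {p c : ℕ} {y z : Fin p → Bool} (h : maskRow y c = maskRow z c) :
    y = z := by
  ext i
  have h2 := congrFun (List.ofFn_injective h) i
  cases hy : y i <;> cases hz : z i <;> simp [hy, hz] at h2 ⊢ <;> omega

theorem maskRow_inj_right {p c d : ℕ} {y : Fin p → Bool} (hc : c < 2 ^ p) (hd : d < 2 ^ p)
    (h : maskRow y c = maskRow y d) : c = d := by
  by_contra hne
  obtain ⟨i, hi, h2⟩ := exists_bitAt_ne hne hc hd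
  have h3 := congrFun (List.ofFn_injective h) ⟨i, hi⟩
  have := bitAt_lt_two c i
  have := bitAt_lt_two d i
  simp only at h3
  omega

/-- The coins split into blocks of length `p`. -/
def blocks (n p : ℕ) : (Fin (n * p) → Bool) ≃ (Fin n → Fin p → Bool) :=
  (Equiv.arrowCongr finProdFinEquiv.symm (Equiv.refl Bool)).trans (Equiv.curry _ _ _)

theorem maskBits_coinBits {n p : ℕ} (f : Fin (n * p) → Bool) (v : Fin n) (c : ℕ) :
    maskBits p (coinBits (List.ofFn f)) v c = maskRow (blocks n p f v) c := by
  refine List.ext_getElem (by simp [maskBits, maskRow]) fun i h1 h2 => ?_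
  have hi : i < p := by simpa [maskBits] using h1
  have hlt : v * p + i < n * p := by
    have := Nat.mul_le_mul_right p (Nat.succ_le_of_lt v.2)
    rw [Nat.succ_mul] at this
    omega
  have h3 : blocks n p f v ⟨i, hi⟩ = f ⟨v * p + i, hlt⟩ := by
    simp only [blocks, Equiv.trans_apply, Equiv.curry_apply, Function.curry,
      Equiv.arrowCongr_apply, Equiv.coe_refl, Function.comp, id, Equiv.symm_symm]
    congr 1
    ext
    simp [finProdFinEquiv]
    ring
  simp [maskBits, maskRow, coinBits, List.getD, h3, hlt]

/-- For a fixed mask at most one value is sent to `a`, and for a fixed value at most one mask sends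
it to `a`. The first fact makes the count 0 or 1, so that 2^k = 1 + k; the second bounds the sum of
the counts by the size of `G`. -/
theorem sum_two_pow_card_le {p : ℕ} (G : Finset ℕ) (hG : ∀ c ∈ G, c < 2 ^ p) (a : List ℕ) :
    ∑ y : Fin p → Bool, 2 ^ (G.filter fun c => maskRow y c = a).card ≤ 2 ^ p + G.card := by
  have h1 : ∀ y : Fin p → Bool, 2 ^ (G.filter fun c => maskRow y c = a).card ≤
      1 + (G.filter fun c => maskRow y c = a).card := by
    intro y
    have : (G.filter fun c => maskRow y c = a).card ≤ 1 := by
      refine Finset.card_le_one.2 fun c hc d hd => ?_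
      rw [Finset.mem_filter] at hc hd
      exact maskRow_inj_right (hG c hc.1) (hG d hd.1) (hc.2.trans hd.2.symm)
    interval_cases (G.filter fun c => maskRow y c = a).card <;> simp
  have h2 : ∑ y : Fin p → Bool, (G.filter fun c => maskRow y c = a).card ≤ G.card := by
    simp only [Finset.card_filter]
    rw [Finset.sum_comm, Finset.card_eq_sum_ones]
    refine Finset.sum_le_sum fun c _ => ?_
    rw [← Finset.card_filter]
    refine Finset.card_le_one.2 fun y hy z hz => ?_
    rw [Finset.mem_filter] at hy hz
    exact maskRow_inj_left (hy.2.trans hz.2.symm)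
  refine (Finset.sum_le_sum fun y _ => h1 y).trans ?_
  rw [Finset.sum_add_distrib]
  simpa using h2

/-- The exponential moment of the number of pairs `(v, c)` in `F` for which the masked bits of `c`
are `a`. -/
theorem sum_two_pow_maskBits_le {n p : ℕ} (F : Finset (ℕ × ℕ))
    (hF : ∀ x ∈ F, x.1 < n ∧ x.2 < 2 ^ p) (hcard : F.card ≤ 2 ^ p) (a : List ℕ) :
    ∑ f : Fin (n * p) → Bool,
      2 ^ (F.filter fun x => maskBits p (coinBits (List.ofFn f)) x.1 x.2 = a).card ≤
      3 * 2 ^ (n * p) := by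
  -- The pairs are grouped by vertex: the blocks of the mask are independent, so the sum over all
  -- coins factors into a product over vertices.
  let G : Fin n → Finset ℕ := fun v => (F.filter fun x => x.1 = (v : ℕ)).image Prod.snd
  have hG : ∀ v, ∀ c ∈ G v, c < 2 ^ p := by
    intro v c hc
    obtain ⟨x, hx, rfl⟩ := Finset.mem_image.1 hc
    exact (hF x (Finset.mem_filter.1 hx).1).2
  have hcardG : ∑ v, (G v).card ≤ F.card := by
    have h1 : ∀ v, (G v).card ≤ (F.filter fun x => x.1 = (v : ℕ)).card := fun v => Finset.card_image_le
    refine (Finset.sum_le_sum fun v _ => h1 v).trans ?_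
    rw [← Finset.card_biUnion fun v _ w _ hvw => ?_]
    · exact Finset.card_le_card fun x hx => by
        obtain ⟨v, -, h⟩ := Finset.mem_biUnion.1 hx
        exact (Finset.mem_filter.1 h).1
    · refine Finset.disjoint_left.2 fun x hx hx' => hvw ?_
      exact Fin.ext ((Finset.mem_filter.1 hx).2.symm.trans (Finset.mem_filter.1 hx').2)
  have hsplit : ∀ f : Fin (n * p) → Bool,
      (F.filter fun x => maskBits p (coinBits (List.ofFn f)) x.1 x.2 = a).card ≤
        ∑ v, ((G v).filter fun c => maskRow (blocks n p f v) c = a).card := by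
    intro f
    have h1 : (F.filter fun x => maskBits p (coinBits (List.ofFn f)) x.1 x.2 = a) ⊆
        Finset.univ.biUnion fun v : Fin n =>
          ((G v).filter fun c => maskRow (blocks n p f v) c = a).image fun c => ((v : ℕ), c) := by
      intro x hx
      rw [Finset.mem_filter] at hx
      have hv := (hF x hx.1).1
      refine Finset.mem_biUnion.2 ⟨⟨x.1, hv⟩, Finset.mem_univ _, Finset.mem_image.2 ⟨x.2, ?_, rfl⟩⟩
      refine Finset.mem_filter.2 ⟨Finset.mem_image.2 ⟨x, Finset.mem_filter.2 ⟨hx.1, rfl⟩, rfl⟩, ?_⟩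
      rw [← maskBits_coinBits]
      exact hx.2
    exact (Finset.card_le_card h1).trans (Finset.card_biUnion_le.trans
      (Finset.sum_le_sum fun v _ => Finset.card_image_le))
  have h1 : ∑ f : Fin (n * p) → Bool,
      2 ^ (F.filter fun x => maskBits p (coinBits (List.ofFn f)) x.1 x.2 = a).card ≤
      ∏ v, (2 ^ p + (G v).card) := by
    calc _ ≤ ∑ f : Fin (n * p) → Bool,
          ∏ v, 2 ^ ((G v).filter fun c => maskRow (blocks n p f v) c = a).card := by
          refine Finset.sum_le_sum fun f _ => ?_
          rw [Finset.prod_pow_eq_pow_sum]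
          exact Nat.pow_le_pow_right two_pos (hsplit f)
      _ = ∑ h : Fin n → Fin p → Bool,
          ∏ v, 2 ^ ((G v).filter fun c => maskRow (h v) c = a).card :=
        (blocks n p).sum_comp fun h => ∏ v, 2 ^ ((G v).filter fun c => maskRow (h v) c = a).card
      _ = ∏ v, ∑ y : Fin p → Bool, 2 ^ ((G v).filter fun c => maskRow y c = a).card := by
        rw [Finset.prod_univ_sum]
        simp
      _ ≤ _ := Finset.prod_le_prod' fun v _ => sum_two_pow_card_le (G v) (hG v) a
  have h2 : ((∏ v, (2 ^ p + (G v).card) : ℕ) : ℝ) ≤ 3 * 2 ^ (n * p) := by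
    push_cast
    have hpos : (0 : ℝ) < 2 ^ p := by positivity
    -- By 1 + x ≤ exp x the product is at most 2^(np) exp(∑ |G v| / 2^p), and the exponent is at
    -- most 1; finally e < 3.
    calc ∏ v, ((2 : ℝ) ^ p + (G v).card)
        ≤ ∏ v : Fin n, (2 ^ p * Real.exp ((G v).card / 2 ^ p)) := by
          refine Finset.prod_le_prod (fun v _ => by positivity) fun v _ => ?_
          have := Real.add_one_le_exp (((G v).card : ℝ) / 2 ^ p)
          calc (2 : ℝ) ^ p + (G v).card = 2 ^ p * ((G v).card / 2 ^ p + 1) := by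
                field_simp
                ring
            _ ≤ _ := mul_le_mul_of_nonneg_left this hpos.le
      _ = 2 ^ (n * p) * Real.exp ((∑ v, ((G v).card : ℝ)) / 2 ^ p) := by
          rw [Finset.prod_mul_distrib, ← Real.exp_sum, ← Finset.sum_div]
          simp [← pow_mul, mul_comm]
      _ ≤ 2 ^ (n * p) * 3 := by
          refine mul_le_mul_of_nonneg_left ?_ (by positivity)
          have h3 : (∑ v, ((G v).card : ℝ)) / 2 ^ p ≤ 1 := by
            rw [div_le_one hpos]
            exact_mod_cast hcardG.trans hcard
          exact (Real.exp_le_exp.2 h3).trans (Real.exp_one_lt_d9.le.trans (by norm_num))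
      _ = _ := mul_comm _ _
  exact h1.trans (by exact_mod_cast h2)

/-- Markov's inequality for the exponential moment, stated by counting coin outcomes. -/
theorem card_maskBits_gt_le {n p : ℕ} (F : Finset (ℕ × ℕ))
    (hF : ∀ x ∈ F, x.1 < n ∧ x.2 < 2 ^ p) (hcard : F.card ≤ 2 ^ p) (a : List ℕ) (X : ℕ) :
    (Finset.univ.filter fun f : Fin (n * p) → Bool =>
      X < (F.filter fun x => maskBits p (coinBits (List.ofFn f)) x.1 x.2 = a).card).card * 2 ^ X ≤
      3 * 2 ^ (n * p) := by
  refine le_trans ?_ (sum_two_pow_maskBits_le F hF hcard a)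
  rw [← smul_eq_mul]
  refine (Finset.card_nsmul_le_sum _ _ (2 ^ X) fun f hf => ?_).trans
    (Finset.sum_le_sum_of_subset (Finset.filter_subset _ _))
  exact Nat.pow_le_pow_right two_pos (Finset.mem_filter.1 hf).2.le

/-- The lists of length `p` with entries `0` and `1`. -/
def bitLists (p : ℕ) : Finset (List ℕ) :=
  Finset.univ.image fun f : Fin p → Fin 2 => List.ofFn fun i => (f i : ℕ)

theorem card_bitLists_le (p : ℕ) : (bitLists p).card ≤ 2 ^ p :=
  Finset.card_image_le.trans (by simp)

theorem maskBits_mem_bitLists (p : ℕ) (R : List ℕ) (v c : ℕ) : maskBits p R v c ∈ bitLists p := by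
  refine Finset.mem_image.2 ⟨fun i => ⟨(bitAt c i + R.getD (v * p + i) 0) % 2,
    Nat.mod_lt _ two_pos⟩, Finset.mem_univ _, ?_⟩
  exact List.ext_getElem (by simp [maskBits]) fun i h1 h2 => by simp [maskBits]

/-- The output contains an edge of high batch degree whose greedy index is large. -/
def Overloaded (X : ℕ) (o : List Out) : Prop :=
  ∃ r ∈ o, ∃ g p q j a, r.2 = encode [g, p, q, j, a] ∧ X < g

open scoped ENNReal in
theorem coinTosses_toOuterMeasure (k : ℕ) (S : Set (List Bool)) [DecidablePred (· ∈ S)] :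
    (coinTosses k).toOuterMeasure S =
      ((Finset.univ.filter fun f : Fin k → Bool => List.ofFn f ∈ S).card : ℝ≥0∞) / 2 ^ k := by
  classical
  rw [coinTosses, PMF.toOuterMeasure_map_apply, PMF.toOuterMeasure_uniformOfFintype_apply]
  rw [Fintype.card_subtype]
  simp

open scoped ENNReal in
-- Union bound over the n possible centers and the at most 2^p masked patterns. The edges of the
-- batch are fixed here, so only the mask is random.
theorem overloaded_colorBatch_le {n : ℕ} {d b : List Edge} (hs : IsEdgeStream n (d ++ b)) (X : ℕ) :
    (coinTosses (n * phase (degList n (d ++ b)))).toOuterMeasure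
      {r | Overloaded X (colorBatch n (degList n (d ++ b)) (coinBits r) b)} ≤
      (n * 2 ^ phase (degList n (d ++ b)) * 3 : ℕ) / 2 ^ X := by
  classical
  set p := phase (degList n (d ++ b)) with hp
  have hsub : {r | Overloaded X (colorBatch n (degList n (d ++ b)) (coinBits r) b)} ⊆
      ⋃ x ∈ Finset.range n ×ˢ bitLists p, {r | X < ((starPairs n p d b x.1).filter fun y =>
        maskBits p (coinBits r) y.1 y.2 = x.2).card} := by
    rintro r ⟨o, ho, g, p', q', j, a, hc, hX⟩
    obtain ⟨q, g', hq, ⟨h, -⟩ | ⟨f, hf, -, h, hg⟩⟩ := mem_colorBatch hs ho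
    · have := encode_injective (hc.symm.trans h)
      simp at this
    · have h2 := encode_injective (hc.symm.trans h)
      simp only [starKey, List.cons.injEq] at h2
      refine Set.mem_biUnion (x := (f.1, maskBits p (coinBits r) f.2 (degree d f.2 + degree q f.2)))
        (Finset.mem_product.2 ⟨Finset.mem_range.2 (orient_bounds hs
          (List.mem_append_right _ (hq.subset (by simp))) hf).1, maskBits_mem_bitLists _ _ _ _⟩) ?_
      exact (h2.1 ▸ hX).trans_le hg
  refine (MeasureTheory.measure_mono hsub).trans
    ((MeasureTheory.measure_biUnion_finset_le _ _).trans ?_)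
  have hone : ∀ x ∈ Finset.range n ×ˢ bitLists p, (coinTosses (n * p)).toOuterMeasure
      {r | X < ((starPairs n p d b x.1).filter fun y =>
        maskBits p (coinBits r) y.1 y.2 = x.2).card} ≤ 3 / 2 ^ X := by
    intro x hx
    have hu := Finset.mem_range.1 (Finset.mem_product.1 hx).1
    have hF : ∀ y ∈ starPairs n p d b x.1, y.1 < n ∧ y.2 < 2 ^ p := by
      intro y hy
      have := (Finset.mem_filter.1 hy).1
      simpa using this
    -- A center has fewer than 2^p edges in the batch by the choice of the phase, which is why masks
    -- of p bits make the expected count at most 1.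
    have hcard : (starPairs n p d b x.1).card ≤ 2 ^ p := by
      refine (card_starPairs_le n p d b x.1).trans ?_
      have h1 := degree_lt_two_pow_phase (d ++ b) hu
      rw [degree_append, ← hp] at h1
      omega
    have h1 := card_maskBits_gt_le _ hF hcard x.2 X
    rw [coinTosses_toOuterMeasure, ENNReal.div_le_iff (by simp) (by simp), ← ENNReal.mul_div_right_comm,
      ENNReal.le_div_iff_mul_le (by simp) (by simp)]
    exact_mod_cast h1
  refine (Finset.sum_le_card_nsmul _ _ _ hone).trans ?_
  rw [Finset.card_product, Finset.card_range, nsmul_eq_mul, ← mul_div_assoc]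
  refine ENNReal.div_le_div_right ?_ _
  have := card_bitLists_le p
  exact_mod_cast Nat.mul_le_mul_right 3 (Nat.mul_le_mul_left n this)

/-! ### The run of the algorithm -/

/-- The buffer after the token `t`. -/
def pushBuffer (n : ℕ) (buf : List Edge) (t : Token) : List Edge :=
  if t.toList = [] ∨ capacity n ≤ (buf ++ t.toList).length then [] else buf ++ t.toList

/-- The buffer after the tokens `ts`. -/
def bufferOf (n : ℕ) (ts : List Token) : List Edge := ts.foldl (pushBuffer n) []

/-- The memory after the edges `e`, with buffer `buf` and random bits `R`. -/
def memOf (n : ℕ) (e buf : List Edge) (R : List ℕ) : Mem :=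
  encState [degList n e, R, buf.map fun e => Nat.pair e.1 e.2]

/-- The records output at the token `t`. -/
def outputAt (n : ℕ) (e buf : List Edge) (t : Token) (R : List ℕ) : List Out :=
  if t.toList = [] ∨ capacity n ≤ (buf ++ t.toList).length then
    colorBatch n (degList n (e ++ t.toList)) R (buf ++ t.toList)
  else []

theorem memDeg_memOf (n : ℕ) (e buf : List Edge) (R : List ℕ) :
    memDeg (memOf n e buf R) = degList n e := by
  rw [memDeg, memOf, decState_encState]
  rfl

theorem memMask_memOf (n : ℕ) (e buf : List Edge) (R : List ℕ) :
    memMask (memOf n e buf R) = R := by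
  rw [memMask, memOf, decState_encState]
  rfl

theorem memBuf_memOf (n : ℕ) (e buf : List Edge) (R : List ℕ) :
    memBuf (memOf n e buf R) = buf := by
  rw [memBuf, memOf, decState_encState]
  simp [List.getD, Function.comp_def]

theorem coins_memOf (n : ℕ) (e buf : List Edge) (R : List ℕ) (t : Token) :
    edgeColoring.coins n (memOf n e buf R) t = n * phase (degList n (e ++ t.toList)) := by
  change n * phase (nextDeg n (memDeg (memOf n e buf R)) t) = _
  rw [memDeg_memOf, nextDeg_degList]

theorem step_memOf (n : ℕ) (e buf : List Edge) (R : List ℕ) (t : Token) (r : List Bool) :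
    edgeColoring.step n (memOf n e buf R) t r =
      (memOf n (e ++ t.toList) (pushBuffer n buf t)
        (nextMask (degList n e) (degList n (e ++ t.toList)) R r),
      outputAt n e buf t (nextMask (degList n e) (degList n (e ++ t.toList)) R r)) := by
  change coreStep n (memDeg (memOf n e buf R)) (memMask (memOf n e buf R))
    (memBuf (memOf n e buf R)) t r = _
  rw [memDeg_memOf, memMask_memOf, memBuf_memOf, coreStep, nextDeg_degList, outputAt, pushBuffer]
  split_ifs <;> rfl

theorem init_eq_memOf (n : ℕ) : edgeColoring.init n = memOf n [] [] [] := rfl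

theorem capacity_pos {n : ℕ} (hn : 0 < n) : 0 < capacity n :=
  Nat.mul_pos hn (pow_pos (Nat.size_pos.2 hn) 2)

theorem threshold_mono (n : ℕ) {p q : ℕ} (h : p ≤ q) : threshold n p ≤ threshold n q :=
  Nat.mul_le_mul_right _ (Nat.pow_le_pow_right two_pos (Nat.div_le_div_right (by omega)))

/-- The colors that the algorithm may use on the stream `s`. -/
def ColorRange (n : ℕ) (s : List Edge) (r : Out) : Prop :=
  (∃ g k, r.2 = encode [g, k] ∧
    ((∃ i ≤ s.length / capacity n, k = 2 * (capacity n * i)) ∨ k = 2 * s.length) ∧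
    g ≤ 2 * threshold n (maxDegree n s).size ∧ g ≤ 2 * maxDegree n s) ∨
  ∃ g p q j α, r.2 = encode [g, p, q, j, encode α] ∧ p ≤ (maxDegree n s).size ∧
    q < 2 * n.size ∧ j ≤ 2 ^ p / threshold n p ∧ threshold n p < 2 ^ p ∧ α ∈ bitLists p

theorem colorRange_of_mem_colorBatch {n : ℕ} (hn : 0 < n) {R : List ℕ} {s d b : List Edge} {r : Out}
    (hs : IsEdgeStream n s) (hp : d ++ b <+: s)
    (hlen : capacity n ∣ (d ++ b).length ∨ (d ++ b).length = s.length)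
    (hr : r ∈ colorBatch n (degList n (d ++ b)) R b) : ColorRange n s r := by
  have hs' := hs.of_prefix hp
  have hph := phase_mono n hp
  rw [phase_degList n s] at hph
  obtain ⟨q, g, hq, ⟨hc, h1, h2⟩ | ⟨o, ho, h1, hc, -⟩⟩ := mem_colorBatch hs' hr
  · refine Or.inl ⟨g, _, hc, ?_, h1.trans (Nat.mul_le_mul_left 2 (threshold_mono n hph)),
      h2.trans (Nat.mul_le_mul_left 2 (maxDegree_mono n hp))⟩
    refine hlen.imp (fun ⟨i, hi⟩ => ⟨i, ?_, by rw [hi]⟩) fun h => by rw [h]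
    rw [Nat.le_div_iff_mul_le (capacity_pos hn), mul_comm, ← hi]
    exact hp.length_le
  · have hb := orient_bounds hs' (List.mem_append_right _ (hq.subset (by simp))) ho
    have h3 := degree_lt_two_pow_phase (d ++ b) hb.1
    refine Or.inr ⟨g, _, _, _, _, hc, hph, side_lt hb.2.2 hb.1 hb.2.1,
      Nat.div_le_div_right h3.le, ?_, maskBits_mem_bitLists _ _ _ _⟩
    rw [degree_append] at h3
    omega

/-- The invariant of the run on the stream `s`, after the edges `e`. -/
def RunInv (n : ℕ) (s e buf : List Edge) (c : Mem × List Out) : Prop :=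
  ∃ R d, c.1 = memOf n e buf R ∧ R.length = n * phase (degList n e) ∧ (∀ x ∈ R, x ≤ 1) ∧
    e = d ++ buf ∧ c.2.map Prod.fst = d ∧ (c.2.Pairwise fun a b => Adj a.1 b.1 → a.2 ≠ b.2) ∧
    (∀ r ∈ c.2, RecordInv n d (phase (degList n e)) R r) ∧ (∀ r ∈ c.2, ColorRange n s r) ∧
    buf.length < capacity n ∧ (capacity n ∣ d.length ∨ d.length = s.length)

theorem length_nextMask {n : ℕ} {deg deg' R : List ℕ} {r : List Bool}
    (hR : R.length = n * phase deg) (hr : r.length = n * phase deg') :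
    (nextMask deg deg' R r).length = n * phase deg' := by
  rw [nextMask]
  split_ifs with h
  · rw [hR, h]
  · simpa using hr

theorem nextMask_le_one {deg deg' R : List ℕ} {r : List Bool} (hR : ∀ x ∈ R, x ≤ 1) :
    ∀ x ∈ nextMask deg deg' R r, x ≤ 1 := by
  rw [nextMask]
  split_ifs with h
  · exact hR
  · intro x hx
    obtain ⟨b, -, rfl⟩ := List.mem_map.1 hx
    cases b <;> simp

/-- The mask is first brought to the new phase, then the batch, if complete, is colored with it. A
batch in which the phase changes is thus colored entirely in the new phase. -/
theorem RunInv.step {n : ℕ} (hn : 0 < n) {s e buf : List Edge} {c : Mem × List Out}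
    (hs : IsEdgeStream n s) (h : RunInv n s e buf c) {t : Token} (he : e ++ t.toList <+: s)
    (ht : t.toList = [] → e = s) {r : List Bool}
    (hr : r.length = n * phase (degList n (e ++ t.toList))) :
    RunInv n s (e ++ t.toList) (pushBuffer n buf t)
      ((edgeColoring.step n c.1 t r).1, c.2 ++ (edgeColoring.step n c.1 t r).2) := by
  obtain ⟨R, d, hm, hR, hR1, hd, hfst, hpw, hrec, hcol, hbuf, hlen⟩ := h
  have hph := phase_mono n (List.prefix_append e t.toList)
  have hrec' : ∀ r' ∈ c.2, RecordInv n d (phase (degList n (e ++ t.toList)))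
      (nextMask (degList n e) (degList n (e ++ t.toList)) R r) r' := fun r' hr' =>
    (hrec r' hr').mono_phase hph fun h => by rw [nextMask, if_pos h]
  have hR' := length_nextMask hR hr
  have hR1' := nextMask_le_one (deg := degList n e) (deg' := degList n (e ++ t.toList)) (r := r) hR1
  rw [hm, step_memOf]
  generalize nextMask (degList n e) (degList n (e ++ t.toList)) R r = R' at *
  refine ⟨R', ?_⟩
  rw [pushBuffer, outputAt]
  have hdb : e ++ t.toList = d ++ (buf ++ t.toList) := by rw [hd, List.append_assoc]
  split_ifs with hflush
  · have hs' := hs.of_prefix he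
    rw [hdb] at hs' he hrec' hR' ⊢
    have hlen' : capacity n ∣ (d ++ (buf ++ t.toList)).length ∨
        (d ++ (buf ++ t.toList)).length = s.length := by
      cases t with
      | none => exact Or.inr (by rw [← hdb, ht rfl]; simp)
      | some f =>
        left
        have h1 := he.length_le
        simp only [Option.toList_some, List.length_append, List.length_cons, List.length_nil,
          List.cons_ne_nil, false_or] at h1 hflush ⊢
        -- An edge still arrives, so the colored edges are not yet the whole stream; only the final
        -- flush may be a partial batch.
        have h2 : capacity n ∣ d.length := hlen.resolve_right (by omega)
        have h3 : buf.length + (0 + 1) = capacity n := by omega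
        rw [h3]
        exact (Nat.dvd_add_right h2).2 dvd_rfl
    refine ⟨d ++ (buf ++ t.toList), rfl, hR', hR1', by simp, ?_, ?_, ?_, ?_, capacity_pos hn, hlen'⟩
    · rw [List.map_append, hfst, map_fst_colorBatch]
    · refine List.pairwise_append.2 ⟨hpw, pairwise_foldl_colorStep _, fun a ha b hb hab => ?_⟩
      exact (hrec' a ha).color_ne hn hs' hb hab
    · intro r' hr'
      rcases List.mem_append.1 hr' with hr' | hr'
      · exact (hrec' r' hr').mono_edges _
      · exact recordInv_of_mem_colorBatch hs' hr'
    · intro r' hr'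
      rcases List.mem_append.1 hr' with hr' | hr'
      · exact hcol r' hr'
      · exact colorRange_of_mem_colorBatch hn hs he hlen' hr'
  · refine ⟨d, rfl, hR', hR1', hdb, ?_, ?_, ?_, ?_, ?_, hlen⟩
    · simpa using hfst
    · simpa using hpw
    · simpa using hrec'
    · simpa using hcol
    · exact not_le.1 fun h => hflush (Or.inr h)

theorem runInv_init {n : ℕ} (hn : 0 < n) (s : List Edge) :
    RunInv n s [] [] (edgeColoring.init n, []) := by
  refine ⟨[], [], init_eq_memOf n, ?_, by simp, rfl, rfl, List.Pairwise.nil, by simp, by simp,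
    capacity_pos hn, Or.inl (dvd_zero _)⟩
  have : maxDegree n [] = 0 := by simp [maxDegree, degree]
  rw [phase_degList, this]
  simp

theorem length_of_mem_support_coinTosses {k : ℕ} {r : List Bool}
    (h : r ∈ (coinTosses k).support) : r.length = k := by
  rw [coinTosses, PMF.mem_support_map_iff] at h
  obtain ⟨f, -, rfl⟩ := h
  simp

theorem run_concat (A : Algorithm) (n : ℕ) (ts : List Token) (t : Token) :
    A.run n (ts ++ [t]) = (A.run n ts).bind fun c => A.execStep n c t := by
  rw [Algorithm.run, Algorithm.run, List.foldl_append, List.foldl_cons, List.foldl_nil]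

theorem bufferOf_concat (n : ℕ) (ts : List Token) (t : Token) :
    bufferOf n (ts ++ [t]) = pushBuffer n (bufferOf n ts) t := by
  rw [bufferOf, bufferOf, List.foldl_append, List.foldl_cons, List.foldl_nil]

theorem RunInv.of_mem_support_concat {n : ℕ} (hn : 0 < n) {s e : List Edge} {ts : List Token}
    (hs : IsEdgeStream n s)
    (h : ∀ c ∈ (edgeColoring.run n ts).support, RunInv n s e (bufferOf n ts) c) {t : Token}
    (he : e ++ t.toList <+: s) (ht : t.toList = [] → e = s) {c : Mem × List Out}
    (hc : c ∈ (edgeColoring.run n (ts ++ [t])).support) :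
    RunInv n s (e ++ t.toList) (bufferOf n (ts ++ [t])) c := by
  rw [run_concat, PMF.mem_support_bind_iff] at hc
  obtain ⟨c₀, hc₀, hc⟩ := hc
  rw [Algorithm.execStep, PMF.mem_support_map_iff] at hc
  obtain ⟨r, hr, rfl⟩ := hc
  have hI := h c₀ hc₀
  have hr' := length_of_mem_support_coinTosses hr
  obtain ⟨R, d, hm, -⟩ := id hI
  rw [hm, coins_memOf] at hr'
  rw [bufferOf_concat]
  exact hI.step hn hs he ht hr'

theorem runInv_of_mem_support {n : ℕ} (hn : 0 < n) {s e : List Edge} (hs : IsEdgeStream n s)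
    (he : e <+: s) : ∀ c ∈ (edgeColoring.run n (e.map some)).support,
      RunInv n s e (bufferOf n (e.map some)) c := by
  induction e using List.reverseRecOn with
  | nil =>
    intro c hc
    obtain rfl : c = (edgeColoring.init n, []) := by simpa [Algorithm.run] using hc
    exact runInv_init hn s
  | append_singleton e f ih =>
    intro c hc
    rw [List.map_append] at hc ⊢
    exact RunInv.of_mem_support_concat hn hs (ih ((List.prefix_append _ _).trans he))
      (t := some f) he (by simp) hc

theorem runInv_of_mem_support_tokens {n : ℕ} (hn : 0 < n) {s : List Edge} (hs : IsEdgeStream n s)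
    {c : Mem × List Out} (hc : c ∈ (edgeColoring.run n (tokens s)).support) :
    RunInv n s s [] c := by
  have := RunInv.of_mem_support_concat hn hs (runInv_of_mem_support hn hs List.prefix_rfl)
    (t := none) (by simp) (fun _ => rfl) hc
  rw [bufferOf_concat] at this
  simpa [pushBuffer] using this

theorem prefix_tokens_concat {s : List Edge} {ts : List Token} {t : Token}
    (h : ts ++ [t] <+: tokens s) :
    ∃ e, ts = e.map some ∧ e ++ t.toList <+: s ∧ (t.toList = [] → e = s) := by
  rw [tokens, List.prefix_concat_iff] at h
  rcases h with h | h
  · obtain ⟨rfl, h2⟩ := List.append_inj' h rfl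
    obtain rfl := List.singleton_inj.1 h2
    exact ⟨s, rfl, by simp, fun _ => rfl⟩
  · obtain ⟨r, hr⟩ := h
    rw [eq_comm, List.map_eq_append_iff] at hr
    obtain ⟨l₁, l₂, rfl, h1, -⟩ := hr
    rw [List.map_eq_append_iff] at h1
    obtain ⟨e, f, rfl, rfl, h2⟩ := h1
    obtain ⟨g, rfl, rfl⟩ := List.map_eq_singleton_iff.1 h2
    exact ⟨e, rfl, by simp, by simp⟩

theorem prefix_tokens {s : List Edge} {ts : List Token} (h : ts <+: tokens s) :
    (∃ e, e <+: s ∧ ts = e.map some) ∨ ts = tokens s := by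
  rw [tokens, List.prefix_concat_iff] at h
  refine h.symm.imp_left fun ⟨r, hr⟩ => ?_
  rw [eq_comm, List.map_eq_append_iff] at hr
  obtain ⟨l₁, l₂, rfl, h1, -⟩ := hr
  exact ⟨l₁, List.prefix_append _ _, h1.symm⟩

/-- Whether or not the random bits are renewed, they are uniformly distributed. -/
theorem bind_nextMask {β : Type} (n : ℕ) (deg deg' : List ℕ) (h : List ℕ → β) :
    ((coinTosses (n * phase deg)).bind fun r₀ => (coinTosses (n * phase deg')).map fun r =>
      h (nextMask deg deg' (coinBits r₀) r)) =
    (coinTosses (n * phase deg')).map fun r => h (coinBits r) := by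
  by_cases hp : phase deg = phase deg'
  · simp only [nextMask, if_pos hp]
    rw [← hp]
    have h1 : ∀ r₀, (coinTosses (n * phase deg)).map (fun _ => h (coinBits r₀)) =
        PMF.pure (h (coinBits r₀)) := fun r₀ => PMF.map_const _ _
    simp only [h1]
    exact PMF.bind_pure_comp _ _
  · simp only [nextMask, if_neg hp]
    exact PMF.bind_const _ _

/-- The joint distribution of the new memory and the new records at the token `t`, if the random
bits in memory are uniformly distributed. -/
theorem bind_step_of_map_fst {n : ℕ} {e : List Edge} {ts : List Token} (t : Token)
    (h : (edgeColoring.run n ts).map Prod.fst = (coinTosses (n * phase (degList n e))).map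
      fun r => memOf n e (bufferOf n ts) (coinBits r)) :
    ((edgeColoring.run n ts).bind fun c => (coinTosses (edgeColoring.coins n c.1 t)).map
      fun r => edgeColoring.step n c.1 t r) =
    (coinTosses (n * phase (degList n (e ++ t.toList)))).map fun r =>
      (memOf n (e ++ t.toList) (pushBuffer n (bufferOf n ts) t) (coinBits r),
        outputAt n e (bufferOf n ts) t (coinBits r)) := by
  have h1 : ((edgeColoring.run n ts).bind fun c => (coinTosses (edgeColoring.coins n c.1 t)).map
      fun r => edgeColoring.step n c.1 t r) =
      ((edgeColoring.run n ts).map Prod.fst).bind fun m =>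
        (coinTosses (edgeColoring.coins n m t)).map fun r => edgeColoring.step n m t r := by
    rw [PMF.bind_map]
    rfl
  rw [h1, h, PMF.bind_map]
  simp only [Function.comp_def, coins_memOf, step_memOf]
  exact bind_nextMask n (degList n e) (degList n (e ++ t.toList)) fun R =>
    (memOf n (e ++ t.toList) (pushBuffer n (bufferOf n ts) t) R,
      outputAt n e (bufferOf n ts) t R)

/-- Degrees and buffer are functions of the fixed stream, so the mask is the only random part of the
memory. Whether it is kept or renewed is decided by the degrees alone, hence it stays uniform. The
output is projected away: jointly with past colors the mask would not be uniform. -/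
theorem map_fst_run (n : ℕ) (e : List Edge) :
    (edgeColoring.run n (e.map some)).map Prod.fst = (coinTosses (n * phase (degList n e))).map
      fun r => memOf n e (bufferOf n (e.map some)) (coinBits r) := by
  induction e using List.reverseRecOn with
  | nil =>
    have h0 : n * phase (degList n []) = 0 := by
      have : maxDegree n [] = 0 := by simp [maxDegree, degree]
      rw [phase_degList, this]
      simp
    have h1 : coinTosses 0 = PMF.pure [] := by
      rw [coinTosses]
      have : (List.ofFn : (Fin 0 → Bool) → List Bool) = fun _ => [] := by
        funext f
        simp
      rw [this]
      exact PMF.map_const _ _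
    rw [h0, h1, PMF.pure_map]
    simp [Algorithm.run, PMF.pure_map, init_eq_memOf, bufferOf, coinBits]
  | append_singleton e f ih =>
    have h := congrArg (PMF.map Prod.fst) (bind_step_of_map_fst (some f) ih)
    rw [PMF.map_bind, PMF.map_comp] at h
    rw [List.map_append, List.map_singleton, run_concat, PMF.map_bind, bufferOf_concat]
    refine Eq.trans ?_ h
    congr 1
    funext c
    rw [Algorithm.execStep, PMF.map_comp, PMF.map_comp]
    rfl

open scoped ENNReal in
-- The union bound is arranged so that the second term involves only the new records; its law
-- depends on the memory alone, and correlations with the past output do not matter.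
theorem overloaded_concat_le (n X : ℕ) (ts : List Token) (t : Token) :
    (edgeColoring.run n (ts ++ [t])).toOuterMeasure {c | Overloaded X c.2} ≤
      (edgeColoring.run n ts).toOuterMeasure {c | Overloaded X c.2} +
      ((edgeColoring.run n ts).bind fun c => (coinTosses (edgeColoring.coins n c.1 t)).map
        fun r => edgeColoring.step n c.1 t r).toOuterMeasure {c | Overloaded X c.2} := by
  rw [run_concat, PMF.toOuterMeasure_bind_apply, PMF.toOuterMeasure_bind_apply,
    PMF.toOuterMeasure_apply, ← ENNReal.tsum_add]
  refine ENNReal.tsum_le_tsum fun c => ?_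
  -- An already overloaded past is paid for by the first term; otherwise an overload must come from
  -- the new records.
  by_cases hc : Overloaded X c.2
  · rw [Set.indicator_of_mem (show c ∈ {c | Overloaded X c.2} from hc)]
    refine le_add_right ?_
    calc _ ≤ (edgeColoring.run n ts) c * 1 := by
          gcongr
          exact (MeasureTheory.measure_mono (Set.subset_univ _)).trans
            ((PMF.toOuterMeasure_apply_eq_one_iff _ _).2 (Set.subset_univ _)).le
      _ = _ := mul_one _
  · refine le_add_left (mul_le_mul' le_rfl ?_)
    rw [Algorithm.execStep, PMF.toOuterMeasure_map_apply, PMF.toOuterMeasure_map_apply]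
    refine MeasureTheory.measure_mono ?_
    rintro r ⟨o, ho, h⟩
    rcases List.mem_append.1 ho with ho | ho
    · exact absurd ⟨o, ho, h⟩ hc
    · exact ⟨o, ho, h⟩

open scoped ENNReal in
theorem overloaded_step_le {n : ℕ} (hn : 0 < n) {s e : List Edge} (hs : IsEdgeStream n s) (X : ℕ)
    {t : Token} (he : e ++ t.toList <+: s) :
    ((edgeColoring.run n (e.map some)).bind fun c => (coinTosses (edgeColoring.coins n c.1 t)).map
        fun r => edgeColoring.step n c.1 t r).toOuterMeasure {c | Overloaded X c.2} ≤
      (n * 2 ^ (maxDegree n s).size * 3 : ℕ) / 2 ^ X := by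
  have hes := (List.prefix_append e t.toList).trans he
  -- The buffer depends on the tokens only, so any one reachable state supplies the splitting of `e`
  -- into colored and buffered edges.
  obtain ⟨c, hc⟩ := (edgeColoring.run n (e.map some)).support_nonempty
  obtain ⟨R, d, -, -, -, hd, -⟩ := runInv_of_mem_support hn hs hes c hc
  rw [bind_step_of_map_fst t (map_fst_run n e), PMF.toOuterMeasure_map_apply]
  set buf := bufferOf n (e.map some)
  have hdb : e ++ t.toList = d ++ (buf ++ t.toList) := by
    conv_lhs => rw [hd, List.append_assoc]
  have hs' := hs.of_prefix he
  have hph := phase_mono n he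
  rw [phase_degList n s] at hph
  by_cases hflush : t.toList = [] ∨ capacity n ≤ (buf ++ t.toList).length
  · rw [hdb] at hs' hph ⊢
    have h1 := overloaded_colorBatch_le hs' X
    refine le_trans (le_of_eq ?_) (h1.trans ?_)
    · congr 1
      ext r
      simp only [Set.mem_preimage, Set.mem_ofPred_eq, outputAt, if_pos hflush, hdb]
    · refine ENNReal.div_le_div_right ?_ _
      exact_mod_cast Nat.mul_le_mul_right 3
        (Nat.mul_le_mul_left n (Nat.pow_le_pow_right two_pos hph))
  · refine le_trans (le_of_eq ?_) zero_le
    rw [PMF.toOuterMeasure_apply_eq_zero_iff, Set.disjoint_left]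
    rintro r - ⟨o, ho, -⟩
    simp only [outputAt, if_neg hflush, List.not_mem_nil] at ho

open scoped ENNReal in
theorem overloaded_run_le {n : ℕ} (hn : 0 < n) {s : List Edge} (hs : IsEdgeStream n s) (X : ℕ)
    (ts : List Token) (h : ts <+: tokens s) :
    (edgeColoring.run n ts).toOuterMeasure {c | Overloaded X c.2} ≤
      ts.length * ((n * 2 ^ (maxDegree n s).size * 3 : ℕ) / 2 ^ X) := by
  induction ts using List.reverseRecOn with
  | nil =>
    refine le_trans (le_of_eq ?_) zero_le
    rw [PMF.toOuterMeasure_apply_eq_zero_iff, Set.disjoint_left]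
    rintro c hc ⟨o, ho, -⟩
    obtain rfl : c = (edgeColoring.init n, []) := by simpa [Algorithm.run] using hc
    simp at ho
  | append_singleton ts t ih =>
    obtain ⟨e, rfl, he, -⟩ := prefix_tokens_concat h
    refine (overloaded_concat_le n X _ t).trans ?_
    refine (add_le_add (ih ((List.prefix_append _ _).trans h))
      (overloaded_step_le hn hs X he)).trans ?_
    rw [List.length_append, List.length_singleton, Nat.cast_add, Nat.cast_one, add_mul, one_mul]

/-! ### Space -/

theorem one_le_log_add_two {x : ℝ} (hx : 1 ≤ x) : 1 ≤ Real.log (x + 2) := by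
  rw [Real.le_log_iff_exp_le (by linarith)]
  have := Real.exp_one_lt_d9
  linarith

theorem size_le_log (x : ℕ) : (x.size : ℝ) ≤ 3 * Real.log (x + 2) := by
  rcases Nat.eq_zero_or_pos x with rfl | hx
  · simpa using Real.log_nonneg (by norm_num)
  · have hx1 : (1 : ℝ) ≤ x := by exact_mod_cast hx
    have h1 := one_le_log_add_two hx1
    have h2 : 2 ^ (x.size - 1) ≤ x := Nat.lt_size.1 (Nat.sub_lt (Nat.size_pos.2 hx) one_pos)
    have h3 : ((x.size - 1 : ℕ) : ℝ) * Real.log 2 ≤ Real.log (x + 2) := by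
      rw [← Real.log_pow]
      refine Real.log_le_log (by positivity) ?_
      have : ((2 ^ (x.size - 1) : ℕ) : ℝ) ≤ x := by exact_mod_cast h2
      push_cast at this
      linarith
    rw [Nat.cast_sub (Nat.size_pos.2 hx), Nat.cast_one] at h3
    have h4 := Real.log_two_gt_d9
    nlinarith

theorem two_pow_size_le {x : ℕ} (hx : 0 < x) : 2 ^ x.size ≤ 2 * x := by
  have h := Nat.lt_size.1 (Nat.sub_lt (Nat.size_pos.2 hx) one_pos)
  have h2 : 2 ^ x.size = 2 * 2 ^ (x.size - 1) := by
    rw [← pow_succ', Nat.sub_add_cancel (Nat.size_pos.2 hx)]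
  omega

theorem size_pair_le {n : ℕ} {e : Edge} (h1 : e.1 < n) (h2 : e.2 < n) :
    (Nat.pair e.1 e.2).size ≤ 2 * n.size := by
  rw [Nat.size_le, two_mul, pow_add]
  have h3 := Nat.pair_lt_max_add_one_sq e.1 e.2
  have h4 : max e.1 e.2 + 1 ≤ 2 ^ n.size :=
    (Nat.succ_le_of_lt (max_lt h1 h2)).trans (Nat.lt_size_self n).le
  have h5 := Nat.mul_le_mul h4 h4
  rw [← sq] at h5
  omega

theorem RunInv.length_le {n : ℕ} (hn : 0 < n) {s e buf : List Edge} {c : Mem × List Out}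
    (hs : IsEdgeStream n s) (he : e <+: s) (h : RunInv n s e buf c) :
    c.1.length ≤ 20 * n * n.size ^ 3 * ((maxDegree n s).size + 1) := by
  obtain ⟨R, d, hm, hR, hR1, hd, -, -, -, -, hbuf, -⟩ := h
  have hph := phase_mono n he
  rw [phase_degList n s] at hph
  have hdeg : ∀ x ∈ degList n e, x.size ≤ (maxDegree n s).size := by
    intro x hx
    obtain ⟨v, hv, rfl⟩ := List.mem_map.1 hx
    exact Nat.size_le_size ((degree_le_of_prefix he v).trans
      (degree_le_maxDegree s (List.mem_range.1 hv)))
  have hb : ∀ x ∈ buf.map (fun e => Nat.pair e.1 e.2), x.size ≤ 2 * n.size := by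
    intro x hx
    obtain ⟨f, hf, rfl⟩ := List.mem_map.1 hx
    have := hs f (he.subset (hd ▸ List.mem_append_right d hf))
    exact size_pair_le this.1 this.2.1
  have hR2 : ∀ x ∈ R, x.size ≤ 1 := fun x hx => by
    simpa using Nat.size_le_size (hR1 x hx)
  have h1 := length_encList_le hdeg
  have h2 := length_encList_le hR2
  have h3 := length_encList_le hb
  rw [hm, memOf, encState]
  simp only [List.flatMap_cons, List.flatMap_nil, List.append_nil, List.length_append]
  rw [show (degList n e).length = n by simp [degList]] at h1
  rw [List.length_map] at h3
  have hL : 1 ≤ n.size := Nat.size_pos.2 hn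
  rw [hR] at h2
  have h4 : n * phase (degList n e) ≤ n * (maxDegree n s).size := Nat.mul_le_mul_left n hph
  -- The buffer dominates: at most nL² edges with 2L-bit codes, and the overhead 4L + 2 per edge is
  -- at most 6L.
  have h5 : buf.length * (2 * (2 * n.size) + 2) ≤ n * n.size ^ 2 * (6 * n.size) :=
    Nat.mul_le_mul hbuf.le (by omega)
  have h6 : n * n.size ^ 2 * (6 * n.size) = 6 * (n * n.size ^ 3) := by ring
  have h7 : n ≤ n * n.size ^ 3 := Nat.le_mul_of_pos_right n (pow_pos hL 3)
  have h8 : n * (maxDegree n s).size ≤ n * n.size ^ 3 * (maxDegree n s).size :=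
    Nat.mul_le_mul_right _ h7
  have h9 : 20 * n * n.size ^ 3 * ((maxDegree n s).size + 1) =
      20 * (n * n.size ^ 3 * (maxDegree n s).size) + 20 * (n * n.size ^ 3) := by ring
  have h10 : n * (2 * (maxDegree n s).size + 2) = 2 * (n * (maxDegree n s).size) + 2 * n := by ring
  rw [h9]
  omega

/-- The constant is 20 · 3³ · 4, from L ≤ 3 log(n+2) and `D.size + 1` ≤ 4 log(n+D+2). -/
theorem space_le_log {n : ℕ} (hn : 0 < n) (D : ℕ) :
    ((20 * n * n.size ^ 3 * (D.size + 1) : ℕ) : ℝ) ≤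
      2160 * n * Real.log (n + 2) ^ 3 * Real.log (n + D + 2) := by
  have hn1 : (1 : ℝ) ≤ n := by exact_mod_cast hn
  have hD : (0 : ℝ) ≤ D := D.cast_nonneg
  have h1 : (n.size : ℝ) ^ 3 ≤ (3 * Real.log (n + 2)) ^ 3 :=
    pow_le_pow_left₀ (Nat.cast_nonneg _) (size_le_log n) 3
  have h2 : (D.size : ℝ) + 1 ≤ 4 * Real.log (n + D + 2) := by
    have h3 := size_le_log D
    have h4 : Real.log (D + 2) ≤ Real.log (n + D + 2) :=
      Real.log_le_log (by positivity) (by linarith)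
    have h5 : 1 ≤ Real.log (n + D + 2) := one_le_log_add_two (by linarith)
    linarith
  push_cast
  calc (20 : ℝ) * n * n.size ^ 3 * (D.size + 1)
      ≤ 20 * n * (3 * Real.log (n + 2)) ^ 3 * (4 * Real.log (n + D + 2)) := by
        have : 0 ≤ Real.log (n + 2) := zero_le_one.trans (one_le_log_add_two hn1)
        gcongr
    _ = _ := by ring

theorem spaceAtMost {n : ℕ} (hn : 0 < n) {s : List Edge} (hs : IsEdgeStream n s) {S : ℝ}
    (hS : ((20 * n * n.size ^ 3 * ((maxDegree n s).size + 1) : ℕ) : ℝ) ≤ S) :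
    edgeColoring.SpaceAtMost n s S := by
  constructor
  · intro ts hts c hc
    refine le_trans ?_ hS
    rcases prefix_tokens hts with ⟨e, he, rfl⟩ | rfl
    · exact_mod_cast (runInv_of_mem_support hn hs he c hc).length_le hn hs he
    · exact_mod_cast (runInv_of_mem_support_tokens hn hs hc).length_le hn hs List.prefix_rfl
  · intro ts t hts c hc
    refine le_trans ?_ hS
    obtain ⟨e, rfl, he, -⟩ := prefix_tokens_concat hts
    obtain ⟨R, d, hm, -⟩ := runInv_of_mem_support hn hs ((List.prefix_append _ _).trans he) c hc
    have hph := phase_mono n he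
    rw [phase_degList n s] at hph
    rw [hm, coins_memOf]
    have h1 : n * phase (degList n (e ++ t.toList)) ≤ 20 * n * n.size ^ 3 *
        ((maxDegree n s).size + 1) := by
      refine Nat.mul_le_mul ?_ (hph.trans (Nat.le_succ _))
      rw [mul_assoc, mul_left_comm]
      exact Nat.le_mul_of_pos_right n (Nat.mul_pos (by norm_num) (pow_pos (Nat.size_pos.2 hn) 3))
    exact_mod_cast h1

/-! ### Properness -/

theorem isProperEdgeColoring_of_mem_support {n : ℕ} (hn : 0 < n) {s : List Edge}
    (hs : IsEdgeStream n s) {o : List Out} (ho : o ∈ (edgeColoring.output n s).support) :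
    IsProperEdgeColoring s o ∧ ∀ r ∈ o, ColorRange n s r := by
  rw [Algorithm.output, PMF.mem_support_map_iff] at ho
  obtain ⟨c, hc, rfl⟩ := ho
  obtain ⟨R, d, -, -, -, hd, hfst, hpw, -, hcol, -⟩ := runInv_of_mem_support_tokens hn hs hc
  rw [List.append_nil] at hd
  refine ⟨⟨?_, hpw.imp fun {a b} h hab => h ((exists_mem_undirected_iff _ _).1 hab)⟩, hcol⟩
  rw [hd, ← hfst, List.map_map]
  exact List.Perm.refl _

/-! ### The number of colors -/

/-- The colors of edges with endpoints of low batch degree. -/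
def lowColors (n : ℕ) (s : List Edge) : Finset ℕ :=
  (Finset.range (2 * min (threshold n (maxDegree n s).size) (maxDegree n s) + 1) ×ˢ
    insert (2 * s.length) ((Finset.range (s.length / capacity n + 1)).image
      fun i => 2 * (capacity n * i))).image fun x => encode [x.1, x.2]

/-- The colors of edges with an endpoint of high batch degree and greedy index at most `X`. -/
def highColors (n X P : ℕ) : Finset ℕ :=
  ((Finset.range (P + 1)).filter fun p => threshold n p < 2 ^ p).biUnion fun p =>
    (Finset.range (X + 1) ×ˢ Finset.range (2 * n.size) ×ˢ
      Finset.range (2 ^ p / threshold n p + 1) ×ˢ bitLists p).image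
      fun x => encode [x.1, p, x.2.1, x.2.2.1, encode x.2.2.2]

theorem ColorRange.mem_colors {n X : ℕ} {s : List Edge} {o : List Out} (h : ¬ Overloaded X o)
    {r : Out} (hr : r ∈ o) (hc : ColorRange n s r) :
    r.2 ∈ lowColors n s ∪ highColors n X (maxDegree n s).size := by
  rcases hc with ⟨g, k, h1, h2, h3, h4⟩ | ⟨g, p, q, j, α, h1, h2, h3, h4, h5, h6⟩
  · refine Finset.mem_union_left _ (Finset.mem_image.2 ⟨(g, k), Finset.mem_product.2 ⟨?_, ?_⟩,
      h1.symm⟩)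
    · rw [Finset.mem_range]
      omega
    · rcases h2 with ⟨i, hi, rfl⟩ | rfl
      · exact Finset.mem_insert_of_mem (Finset.mem_image_of_mem _
          (Finset.mem_range.2 (Nat.lt_succ_of_le hi)))
      · exact Finset.mem_insert_self _ _
  · have hg : g ≤ X := by
      by_contra! hg
      exact h ⟨r, hr, g, p, q, j, _, h1, hg⟩
    refine Finset.mem_union_right _ (Finset.mem_biUnion.2 ⟨p, Finset.mem_filter.2
      ⟨Finset.mem_range.2 (Nat.lt_succ_of_le h2), h5⟩, Finset.mem_image.2 ⟨(g, q, j, α), ?_,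
      h1.symm⟩⟩)
    simp only [Finset.mem_product, Finset.mem_range]
    exact ⟨Nat.lt_succ_of_le hg, h3, Nat.lt_succ_of_le h4, h6⟩

theorem numColors_le {n X : ℕ} {s : List Edge} {o : List Out} (h : ¬ Overloaded X o)
    (hc : ∀ r ∈ o, ColorRange n s r) :
    numColors o ≤ (lowColors n s).card + (highColors n X (maxDegree n s).size).card := by
  refine (Finset.card_le_card fun x hx => ?_).trans (Finset.card_union_le _ _)
  obtain ⟨r, hr, rfl⟩ := List.mem_map.1 (List.mem_toFinset.1 hx)
  exact (hc r hr).mem_colors h hr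

theorem two_pow_half_le_sqrt (p : ℕ) {x : ℝ} (h : (2 : ℝ) ^ p ≤ x) :
    (2 : ℝ) ^ (p / 2) ≤ Real.sqrt x := by
  refine Real.le_sqrt_of_sq_le (le_trans ?_ h)
  rw [← pow_mul]
  exact pow_le_pow_right₀ one_le_two (Nat.div_mul_le_self p 2)

theorem cast_threshold (n p : ℕ) :
    (threshold n p : ℝ) = 2 ^ ((p + 1) / 2) * (n.size : ℝ) ^ 2 := by
  simp [threshold]

/-- The number of batches is at most of order Δ/L² and each uses O(√Δ L²) indices, so the powers of
L cancel. -/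
theorem card_lowColors_le {n : ℕ} (hn : 0 < n) {s : List Edge} (hs : IsEdgeStream n s)
    (hD : 0 < maxDegree n s) :
    ((lowColors n s).card : ℝ) ≤ 9 * (maxDegree n s * Real.sqrt (maxDegree n s)) := by
  set D := maxDegree n s with hDdef
  set P := D.size
  set m := s.length with hm
  have hD1 : (1 : ℝ) ≤ D := by exact_mod_cast hD
  have hsq : 1 ≤ Real.sqrt D := Real.one_le_sqrt.2 hD1
  have h1 : (lowColors n s).card ≤ (2 * min (threshold n P) D + 1) * (m / capacity n + 2) := by
    refine Finset.card_image_le.trans ?_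
    rw [Finset.card_product, Finset.card_range]
    refine Nat.mul_le_mul_left _ ((Finset.card_insert_le _ _).trans ?_)
    have := Finset.card_image_le (s := Finset.range (m / capacity n + 1))
      (f := fun i => 2 * (capacity n * i))
    rw [Finset.card_range] at this
    rw [← hm]
    omega
  -- With less than one full batch there is no division by L² to gain, and the index bound 2D
  -- replaces the threshold. Otherwise the additive 2 in the number of batches is absorbed.
  rcases lt_or_ge m (capacity n) with hlt | hge
  · rw [Nat.div_eq_of_lt hlt] at h1
    have h2 : (lowColors n s).card ≤ 6 * D := by
      refine h1.trans ?_
      have := min_le_right (threshold n P) D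
      omega
    have h3 : ((lowColors n s).card : ℝ) ≤ 6 * D := by exact_mod_cast h2
    nlinarith
  · have hcap : (0 : ℝ) < capacity n := by exact_mod_cast capacity_pos hn
    have hL : (1 : ℝ) ≤ n.size := by exact_mod_cast Nat.size_pos.2 hn
    have hn0 : (0 : ℝ) < n := by exact_mod_cast hn
    have hmge : (1 : ℝ) ≤ m / capacity n := by
      rw [le_div_iff₀ hcap, one_mul]
      exact_mod_cast hge
    have h2 : ((m / capacity n + 2 : ℕ) : ℝ) ≤ 3 * (m / capacity n) := by
      push_cast
      have : ((m / capacity n : ℕ) : ℝ) ≤ (m : ℝ) / capacity n := Nat.cast_div_le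
      linarith
    have h3 : (m : ℝ) / capacity n ≤ D / (2 * (n.size : ℝ) ^ 2) := by
      rw [div_le_div_iff₀ hcap (by positivity), capacity]
      have h4 : 2 * (m : ℝ) ≤ n * D := by exact_mod_cast two_mul_length_le hs
      push_cast
      nlinarith [mul_le_mul_of_nonneg_right h4 (sq_nonneg (n.size : ℝ))]
    have h4 : (threshold n P : ℝ) ≤ 2 * Real.sqrt D * (n.size : ℝ) ^ 2 := by
      rw [cast_threshold]
      refine mul_le_mul_of_nonneg_right ?_ (sq_nonneg _)
      -- The threshold rounds p/2 up, hence the exponent P + 1 and the factor 4 under the square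
      -- root.
      have h5 : (2 : ℝ) ^ (P + 1) ≤ 2 ^ 2 * D := by
        have : ((2 ^ P : ℕ) : ℝ) ≤ ((2 * D : ℕ) : ℝ) := by exact_mod_cast two_pow_size_le hD
        push_cast at this
        rw [pow_succ]
        linarith
      have h6 := two_pow_half_le_sqrt (P + 1) h5
      rwa [Real.sqrt_mul (by positivity), Real.sqrt_sq (by norm_num)] at h6
    have h5 : ((2 * min (threshold n P) D + 1 : ℕ) : ℝ) ≤ 3 * threshold n P := by
      have h6 := threshold_pos hn P
      have h7 : 2 * min (threshold n P) D + 1 ≤ 3 * threshold n P := by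
        have := min_le_left (threshold n P) D
        omega
      exact_mod_cast h7
    calc ((lowColors n s).card : ℝ)
        ≤ ((2 * min (threshold n P) D + 1 : ℕ) : ℝ) * ((m / capacity n + 2 : ℕ) : ℝ) := by
          exact_mod_cast h1
      _ ≤ (3 * (2 * Real.sqrt D * (n.size : ℝ) ^ 2)) * (3 * (D / (2 * (n.size : ℝ) ^ 2))) := by
          refine mul_le_mul (h5.trans (by linarith)) (h2.trans (by linarith)) (Nat.cast_nonneg _)
            (by positivity)
      _ = 9 * (D * Real.sqrt D) := by
          field_simp
          ring

/-- Stated with the factor `n.size` on the left: labels cost 2L while the quotients gain L², so one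
factor L is left over to cancel the log n in `X`. -/
theorem card_highColors_le {n : ℕ} (hn : 0 < n) (X : ℕ) {D : ℕ} (hD : 0 < D) :
    ((highColors n X D.size).card : ℝ) * n.size ≤
      12 * (D.size + 1) * (X + 1) * (D * Real.sqrt D) := by
  have hL : (0 : ℝ) < n.size := by exact_mod_cast Nat.size_pos.2 hn
  have hD0 : (0 : ℝ) < D := by exact_mod_cast hD
  have hone : ∀ p ∈ (Finset.range (D.size + 1)).filter (fun p => threshold n p < 2 ^ p),
      (((Finset.range (X + 1) ×ˢ Finset.range (2 * n.size) ×ˢ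
        Finset.range (2 ^ p / threshold n p + 1) ×ˢ bitLists p).image
        fun x => encode [x.1, p, x.2.1, x.2.2.1, encode x.2.2.2]).card : ℝ) ≤
      12 * (X + 1) * (D * Real.sqrt D) / n.size := by
    intro p hp
    obtain ⟨hp, ht⟩ := Finset.mem_filter.1 hp
    have hp : p ≤ D.size := Nat.lt_succ_iff.1 (Finset.mem_range.1 hp)
    have h1 : ((Finset.range (X + 1) ×ˢ Finset.range (2 * n.size) ×ˢ
        Finset.range (2 ^ p / threshold n p + 1) ×ˢ bitLists p).image
        fun x => encode [x.1, p, x.2.1, x.2.2.1, encode x.2.2.2]).card ≤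
        (X + 1) * (2 * n.size * ((2 ^ p / threshold n p + 1) * 2 ^ p)) := by
      refine Finset.card_image_le.trans ?_
      simp only [Finset.card_product, Finset.card_range]
      gcongr
      exact card_bitLists_le p
    have hτ : (0 : ℝ) < threshold n p := by exact_mod_cast threshold_pos hn p
    -- Only phases with threshold below 2^p have high edges at all; there the quotient is at least 1
    -- and the additive 1 is absorbed.
    have h2 : ((2 ^ p / threshold n p + 1 : ℕ) : ℝ) ≤ 2 * (2 ^ p / threshold n p) := by
      have h3 : ((2 ^ p / threshold n p : ℕ) : ℝ) ≤ ((2 ^ p : ℕ) : ℝ) / threshold n p :=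
        Nat.cast_div_le
      have h4 : (1 : ℝ) ≤ 2 ^ p / threshold n p := by
        rw [le_div_iff₀ hτ, one_mul]
        exact_mod_cast ht.le
      push_cast at h3 ⊢
      linarith
    have hpD : (2 : ℝ) ^ p ≤ 2 * D := by
      have h3 : 2 ^ p ≤ 2 * D :=
        (Nat.pow_le_pow_right two_pos hp).trans (two_pow_size_le hD)
      exact_mod_cast h3
    have h3 : (2 : ℝ) ^ p / threshold n p = 2 ^ (p / 2) / (n.size : ℝ) ^ 2 := by
      rw [cast_threshold, div_eq_div_iff (by positivity) (by positivity)]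
      have h4 : (2 : ℝ) ^ p = 2 ^ (p / 2) * 2 ^ ((p + 1) / 2) := by
        rw [← pow_add]
        congr 1
        omega
      rw [h4]
      ring
    -- The constant 3/2 is a rational upper bound for √2.
    have h5 : Real.sqrt (2 * D) ≤ 3 / 2 * Real.sqrt D := by
      rw [Real.sqrt_mul (by norm_num)]
      refine mul_le_mul_of_nonneg_right ?_ (Real.sqrt_nonneg _)
      rw [Real.sqrt_le_left (by norm_num)]
      norm_num
    have h6 := (two_pow_half_le_sqrt p hpD).trans h5
    calc _ ≤ (((X + 1) * (2 * n.size * ((2 ^ p / threshold n p + 1) * 2 ^ p)) : ℕ) : ℝ) := by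
          exact_mod_cast h1
      _ = (X + 1) * (2 * n.size * (((2 ^ p / threshold n p + 1 : ℕ) : ℝ) * 2 ^ p)) := by
          push_cast
          ring
      _ ≤ (X + 1) * (2 * n.size * ((2 * (3 / 2 * Real.sqrt D / (n.size : ℝ) ^ 2)) * (2 * D))) := by
          rw [h3] at h2
          have h7 := h2.trans (mul_le_mul_of_nonneg_left
            (div_le_div_of_nonneg_right h6 (sq_nonneg (n.size : ℝ))) zero_le_two)
          gcongr
      _ = 12 * (X + 1) * (D * Real.sqrt D) / n.size := by
          field_simp
          ring
  have h1 : ((highColors n X D.size).card : ℝ) ≤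
      (D.size + 1) * (12 * (X + 1) * (D * Real.sqrt D) / n.size) := by
    have h2 : (highColors n X D.size).card ≤ _ := Finset.card_biUnion_le
    refine (Nat.cast_le.2 h2).trans ?_
    rw [Nat.cast_sum]
    refine (Finset.sum_le_card_nsmul _ _ _ hone).trans ?_
    rw [nsmul_eq_mul]
    refine mul_le_mul_of_nonneg_right ?_ (by positivity)
    have h3 := Finset.card_filter_le (Finset.range (D.size + 1)) fun p => threshold n p < 2 ^ p
    rw [Finset.card_range] at h3
    exact_mod_cast h3
  calc _ ≤ (D.size + 1) * (12 * (X + 1) * (D * Real.sqrt D) / n.size) * n.size :=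
        mul_le_mul_of_nonneg_right h1 hL.le
    _ = _ := by
        field_simp

theorem rpow_three_halves {x : ℝ} (hx : 0 ≤ x) : x ^ (3 / 2 : ℝ) = x * Real.sqrt x := by
  rw [Real.sqrt_eq_rpow, show (3 / 2 : ℝ) = 1 + 1 / 2 by norm_num,
    Real.rpow_add_of_nonneg hx zero_le_one (by norm_num), Real.rpow_one]

/-- The bound on the greedy indices that holds with high probability. -/
def overload (K n D : ℕ) : ℕ := (K + 2) * n.size + 2 * D.size + 2

theorem numColors_le_log {n K : ℕ} (hn : 0 < n) {s : List Edge} {o : List Out}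
    (hs : IsEdgeStream n s) (h : ¬ Overloaded (overload K n (maxDegree n s)) o)
    (ho : IsProperEdgeColoring s o) (hc : ∀ r ∈ o, ColorRange n s r) :
    (numColors o : ℝ) ≤ 2160 * (K + 6) * (maxDegree n s : ℝ) ^ (3 / 2 : ℝ) *
      Real.log (maxDegree n s + 2) ^ 3 := by
  rcases Nat.eq_zero_or_pos (maxDegree n s) with h0 | hD
  · have h1 := two_mul_length_le hs
    rw [h0, mul_zero] at h1
    -- Without edges the output is empty, and the claimed bound is 0.
    have h2 : o = [] := by
      have := ho.1.length_eq
      rw [List.length_map, List.length_map] at this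
      exact List.eq_nil_of_length_eq_zero (by omega)
    rw [h2, h0]
    simp [numColors]
  · set D := maxDegree n s
    set X := overload K n D with hX
    have hD1 : (1 : ℝ) ≤ D := by exact_mod_cast hD
    have hL : (1 : ℝ) ≤ n.size := by exact_mod_cast Nat.size_pos.2 hn
    have hP : (0 : ℝ) ≤ D.size := Nat.cast_nonneg _
    have hK : (0 : ℝ) ≤ K := Nat.cast_nonneg _
    have hlog := one_le_log_add_two hD1
    set ℓ := Real.log (D + 2)
    rw [rpow_three_halves (by linarith)]
    set W := (D : ℝ) * Real.sqrt D
    have hW : 0 ≤ W := by positivity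
    have hlow := card_lowColors_le hn hs hD
    have hhigh := card_highColors_le hn X hD
    have hX1 : (X : ℝ) + 1 ≤ (K + 5) * n.size * (D.size + 1) := by
      rw [hX, overload]
      push_cast
      nlinarith [mul_nonneg (mul_nonneg hK (zero_le_one.trans hL)) hP,
        mul_nonneg (sub_nonneg.2 hL) hP]
    have hhigh' : ((highColors n X D.size).card : ℝ) ≤ 12 * (K + 5) * (D.size + 1) ^ 2 * W := by
      -- Here the factor `n.size` in `X + 1` cancels, and no dependence on n remains.
      refine le_of_mul_le_mul_right (hhigh.trans ?_) (zero_lt_one.trans_le hL)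
      calc 12 * ((D.size : ℝ) + 1) * (X + 1) * W
          ≤ 12 * ((D.size : ℝ) + 1) * ((K + 5) * n.size * (D.size + 1)) * W := by gcongr
        _ = _ := by ring
    have hP1 : (D.size : ℝ) + 1 ≤ 4 * ℓ := by
      have := size_le_log D
      linarith
    have hnum : (numColors o : ℝ) ≤
        (lowColors n s).card + (highColors n X D.size).card := by
      exact_mod_cast numColors_le h hc
    have h1 : (1 : ℝ) ≤ ((D.size : ℝ) + 1) ^ 2 := by nlinarith
    calc (numColors o : ℝ) ≤ 9 * W + 12 * (K + 5) * (D.size + 1) ^ 2 * W := by linarith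
      _ ≤ 12 * ((D.size : ℝ) + 1) ^ 2 * W + 12 * (K + 5) * (D.size + 1) ^ 2 * W := by
          have := mul_le_mul_of_nonneg_right h1 hW
          linarith
      _ = 12 * (K + 6) * (D.size + 1) ^ 2 * W := by ring
      _ ≤ 12 * (K + 6) * (4 * ℓ) ^ 2 * W := by gcongr
      _ = 192 * (K + 6) * W * ℓ ^ 2 := by ring
      _ ≤ 2160 * (K + 6) * W * ℓ ^ 3 := by
          have h2 : ℓ ^ 2 ≤ ℓ ^ 3 := pow_le_pow_right₀ hlog (by norm_num)
          have : (192 : ℝ) ≤ 2160 := by norm_num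
          gcongr

/-! ### The probability of overload -/

open scoped ENNReal in
-- There are at most n 2^P tokens with P = `D.size`, each failing with probability at most 3n 2^P /
-- 2^X. The summands of `overload` match the factors n^(K+2), 2^(2P) and 4 ≥ 3 one by one.
theorem overloaded_output_le {n : ℕ} (hn : 0 < n) (K : ℕ) {s : List Edge}
    (hs : IsEdgeStream n s) :
    (edgeColoring.output n s).toOuterMeasure
      {o | Overloaded (overload K n (maxDegree n s)) o} ≤ ((n : ℝ≥0∞) ^ K)⁻¹ := by
  rw [Algorithm.output, PMF.toOuterMeasure_map_apply]
  refine (overloaded_run_le hn hs _ (tokens s) List.prefix_rfl).trans ?_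
  set D := maxDegree n s with hD
  have hn0 : (n : ℝ≥0∞) ^ K ≠ 0 := pow_ne_zero _ (by exact_mod_cast hn.ne')
  have hnt : (n : ℝ≥0∞) ^ K ≠ ∞ := ENNReal.pow_ne_top (ENNReal.natCast_ne_top n)
  rw [← one_div, ENNReal.le_div_iff_mul_le (Or.inl hn0) (Or.inl hnt), ← mul_div_assoc,
    ← ENNReal.mul_div_right_comm, ENNReal.div_le_iff (by simp) (by simp), one_mul]
  have h1 : (tokens s).length = s.length + 1 := by simp [tokens]
  have h2 : 2 * s.length ≤ n * D := two_mul_length_le hs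
  have h3 : D + 1 ≤ 2 ^ D.size := Nat.lt_size_self D
  have h4 : n ≤ 2 ^ n.size := (Nat.lt_size_self n).le
  have h5 : (tokens s).length ≤ n * 2 ^ D.size := by
    rw [h1]
    refine le_trans ?_ (Nat.mul_le_mul_left n h3)
    rw [mul_add]
    omega
  have h6 : (tokens s).length * (n * 2 ^ D.size * 3) * n ^ K ≤ 2 ^ overload K n D := by
    calc (tokens s).length * (n * 2 ^ D.size * 3) * n ^ K
        ≤ (n * 2 ^ D.size) * (n * 2 ^ D.size * 4) * n ^ K := by gcongr; norm_num
      _ = n ^ (K + 2) * 2 ^ (2 * D.size + 2) := by ring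
      _ ≤ (2 ^ n.size) ^ (K + 2) * 2 ^ (2 * D.size + 2) := by gcongr
      _ = 2 ^ overload K n D := by
        rw [overload, ← pow_mul, ← pow_add]
        congr 1
        ring
  exact_mod_cast h6

end WStreaming

/-! ### The main theorem. -/

theorem theorem1 (K : ℕ) :
    ∃ (A : WStreaming.Algorithm) (C : ℝ) (c : ℕ),
      ∀ n : ℕ, 0 < n → ∀ s : List WStreaming.Edge, WStreaming.IsEdgeStream n s →
        A.SpaceAtMost n s
          (C * n * Real.log (n + 2) ^ c * Real.log (n + WStreaming.maxDegree n s + 2)) ∧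
        (∀ o ∈ (A.output n s).support, WStreaming.IsProperEdgeColoring s o) ∧
        ENNReal.ofReal (1 - 1 / (n : ℝ) ^ K) ≤
          (A.output n s).toOuterMeasure
            {o | (WStreaming.numColors o : ℝ) ≤
              C * (WStreaming.maxDegree n s : ℝ) ^ (3 / 2 : ℝ) *
                Real.log (WStreaming.maxDegree n s + 2) ^ c} := by
  refine ⟨WStreaming.edgeColoring, 2160 * (K + 6), 3, fun n hn s hs => ⟨?_, fun o ho =>
    (WStreaming.isProperEdgeColoring_of_mem_support hn hs ho).1, ?_⟩⟩
  · refine WStreaming.spaceAtMost hn hs ((WStreaming.space_le_log hn _).trans ?_)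
    have h1 : 0 ≤ Real.log ((n : ℝ) + 2) := Real.log_nonneg (by linarith [n.cast_nonneg (α := ℝ)])
    have h2 : 0 ≤ Real.log ((n : ℝ) + WStreaming.maxDegree n s + 2) := by
      refine Real.log_nonneg ?_
      have h3 : (0 : ℝ) ≤ n := n.cast_nonneg
      have h4 : (0 : ℝ) ≤ WStreaming.maxDegree n s := Nat.cast_nonneg _
      linarith
    have h3 : (2160 : ℝ) ≤ 2160 * (K + 6) := by linarith [K.cast_nonneg (α := ℝ)]
    gcongr
  · set μ := (WStreaming.edgeColoring.output n s).toOuterMeasure with hμ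
    set good := {o | (WStreaming.numColors o : ℝ) ≤
      2160 * (K + 6) * (WStreaming.maxDegree n s : ℝ) ^ (3 / 2 : ℝ) *
        Real.log (WStreaming.maxDegree n s + 2) ^ 3} with hgood
    set bad := {o | WStreaming.Overloaded
      (WStreaming.overload K n (WStreaming.maxDegree n s)) o} with hbad
    -- Every possible output is good or overloaded, so no measurability is needed: subadditivity of
    -- the outer measure suffices.
    have h1 : 1 ≤ μ good + μ bad := by
      refine le_trans (le_of_eq ?_) (MeasureTheory.measure_union_le good bad)
      refine ((PMF.toOuterMeasure_apply_eq_one_iff _ _).2 fun o ho => ?_).symm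
      obtain ⟨h2, h3⟩ := WStreaming.isProperEdgeColoring_of_mem_support hn hs ho
      by_cases h4 : o ∈ bad
      · exact Or.inr h4
      · exact Or.inl (WStreaming.numColors_le_log hn hs h4 h2 h3)
    have h2 : μ bad ≤ ENNReal.ofReal (1 / (n : ℝ) ^ K) := by
      refine (WStreaming.overloaded_output_le hn K hs).trans (le_of_eq ?_)
      have h3 : (0 : ℝ) < n := by exact_mod_cast hn
      rw [one_div, ENNReal.ofReal_inv_of_pos (pow_pos h3 K), ENNReal.ofReal_pow h3.le,
        ENNReal.ofReal_natCast]
    rw [ENNReal.ofReal_sub _ (by positivity), ENNReal.ofReal_one, tsub_le_iff_right]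
    exact h1.trans (add_le_add le_rfl h2)
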